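/- **Conventions.** Hilbert spaces are real and separable. Let $(Z,\mathcal Z,\nu)$ be a probability space; "$\nu$-measurable" means measurable with respect to the completion of $\mathcal Z$. A space $S\subset\prod_\zeta H_\zeta$ of *$\nu$-measurable vector fields* is a linear subspace such that (a) $\zeta\mapsto\|u_\zeta\|$ is $\nu$-measurable for all $u\in S$; (b) if $v\in \prod_\zeta H_\zeta$ and $\zeta\mapsto\langle u_\zeta,v_\zeta\rangle$ is $\nu$-measurable for all $u\in S$, then $v\in S$; (c) there are $u_1,u_2,\dots\in S$ such that $(u_{n,\zeta})_n$ is total in $H_\zeta$ for every $\zeta$. The direct integral $\int^{\oplus}_Z H_\zeta\,d\nu(\zeta)$ is the space of square-integrable fields in $S$ with inner product $\int\langle u_\zeta,v_\zeta\rangle\,d\nu(\zeta)$, modulo fields of norm $0$. A field of bounded operators $U_\zeta:H^1_\zeta\to H^2_\zeta$ is *$\nu$-measurable* if $(U_\zeta u_\zeta)_\zeta\in S^2$ for all $u\in S^1$; if it is $\nu$-essentially bounded, $\int^{\oplus}U_\zeta\,d\nu(\zeta)$ is the operator $[u]\mapsto[(U_\zeta u_\zeta)_\zeta]$. For a closed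 densely defined non-negative quadratic form $Q$ on $H$, $D(Q)_1$ is $D(Q)$ with inner product $Q_1(u,v)=Q(u,v)+\langle u,v\rangle$, and the semigroup of $Q$ is the strongly continuous contraction semigroup generated by the operator $L$ given by: $u\in D(L)$, $Lu=w$ iff $u\in D(Q)$ and $Q(u,v)=\langle -w,v\rangle$ for all $v\in D(Q)$. A *$\nu$-measurable field* of such forms $Q_\zeta$ on $H_\zeta$ consists of the forms together with spaces $S_H\subset\prod_\zeta H_\zeta$ and $S_Q\subset\prod_\zeta D(Q_\zeta)_1$ of $\nu$-measurable vector fields with $S_Q\subset S_H$. Its direct integral $Q=\int^{\oplus}Q_\zeta\,d\nu(\zeta)$ is the form on $\int^{\oplus}H_\zeta\,d\nu(\zeta)$ with domain the classes of those $u\in S_Q$ with $\int Q_{\zeta,1}(u_\zeta)\,d\nu(\zeta)<\infty$, and $Q(u,v)=\int Q_\zeta(u_\zeta,v_\zeta)\,d\nu(\zeta)$. A *Dirichlet form* on $L^2(m)$ is a densely defined closed form $E$ with $f^+\wedge 1\in D(E)$ and $E(f^+\wedge1)\le E(f)$ for all $f\in D(E)$. A *unitary order isomorphism* between $L^2$-spaces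 is a surjective linear isometry that preserves the order together with its inverse. A *pseudo-disintegration* of a measure $\mu$ on $(X,\mathcal X)$ over $\nu$ is a family $(\mu_\zeta)_{\zeta\in Z}$ of non-zero measures on $(X,\mathcal X)$ such that, for all $A\in\mathcal X$, $\zeta\mapsto\mu_\zeta A$ is $\nu$-measurable and $\mu A=\int\mu_\zeta A\,d\nu(\zeta)$. For a $\mu$-measurable map $s:X\to Z$ it is *$s$-separated* if the sets $s^{-1}(\zeta)$, $\zeta\in Z$, are pairwise disjoint, $\mu$-measurable, and $s^{-1}(\zeta)$ is $\mu_\zeta$-conegligible for $\nu$-a.e. $\zeta$. For $f\in\mathcal L^2(\mu)$ let $\delta(f)_\zeta\in L^2(\mu_\zeta)$ be the class of $f$ if $f\in\mathcal L^2(\mu_\zeta)$, and $0$ otherwise. A $\nu$-measurable field of forms $Q_\zeta$ on $L^2(\mu_\zeta)$ is *compatible* with $(\mu_\zeta)$ if there is a linear subspace $\mathcal A\subset\mathcal L^2(\mu)$ whose classes are dense in $L^2(\mu)$ such that $S_H$ is the space of $\nu$-measurable vector fields containing $\delta(\mathcal A)$, $S_Q=S_H\cap\prod_\zeta D(Q_\zeta)$,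 and $[\delta(f)]\in D(Q)$ for all $f\in\mathcal A$. **Proposition.** Let $(X,\mathcal X,\mu)$ be a locally compact Polish space with its Borel $\sigma$-algebra and a Radon measure, $(Z,\mathcal Z,\nu)$ a countably generated probability space such that $\mathcal Z$ contains all singletons, and $s:X\to Z$ a $\mu$-measurable map. For $i=1,2$ let $(\mu^i_\zeta)_{\zeta\in Z}$ be an $s$-separated pseudo-disintegration of $\mu$ over $\nu$, and $\zeta\mapsto E^i_\zeta$ a $\nu$-measurable field of Dirichlet forms on $L^2(\mu^i_\zeta)$, compatible with $(\mu^i_\zeta)$, with semigroups $(T^i_{\zeta,t})_{t\ge0}$. Let $\zeta\mapsto U_\zeta$ be a $\nu$-measurable field of bounded operators $U_\zeta:L^2(\mu^1_\zeta)\to L^2(\mu^2_\zeta)$ such that, for $\nu$-a.e. $\zeta$, $U_\zeta$ is a unitary order isomorphism and $T^2_{\zeta,t}U_\zeta=U_\zeta T^1_{\zeta,t}$ for all $t\ge0$. Then, for $i=1,2$, the map $[f]\mapsto[\delta(f)]$ is a well-defined unitary operator $\iota^i$ from $L^2(\mu)$ onto $\int^{\oplus}L^2(\mu^i_\zeta)\,d\nu(\zeta)$.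 Let $E^i$ be the form on $L^2(\mu)$ corresponding to $\int^{\oplus}E^i_\zeta\,d\nu(\zeta)$ under $\iota^i$. The direct integral operator $\int^{\oplus}U_\zeta\,d\nu(\zeta)$ is well-defined, and the corresponding operator $U:=(\iota^2)^{-1}\circ\int^{\oplus}U_\zeta\,d\nu(\zeta)\circ\iota^1$ on $L^2(\mu)$ is a unitary order isomorphism which intertwines $E^1$ and $E^2$, that is, $$U D(E^1)=D(E^2),\qquad E^2(Uf,Ug)=E^1(f,g)\quad (f,g\in D(E^1)),$$ and which intertwines their semigroups: $T^2_tU=UT^1_t$ for all $t\ge0$. -/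

import Mathlib

open MeasureTheory Filter Topology
open scoped ENNReal NNReal

noncomputable section

/-! ### Quadratic forms -/

/-- A non-negative symmetric quadratic form on a real Hilbert space, given by its domain (a linear
subspace) and its symmetric bilinear form on the domain. -/
structure QuadForm (H : Type*) [NormedAddCommGroup H] [InnerProductSpace ℝ H] where
  domain : Submodule ℝ H
  form : domain →ₗ[ℝ] domain →ₗ[ℝ] ℝ
  symm : ∀ u v, form u v = form v u
  nonneg : ∀ u, 0 ≤ form u u

namespace QuadForm

variable {H : Type*} [NormedAddCommGroup H] [InnerProductSpace ℝ H]
variable {G : Type*} [NormedAddCommGroup G] [InnerProductSpace ℝ G]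

/-- The domain of `Q`, regarded as a space of its own which is going to carry the inner product
`Q₁(u, v) = Q(u, v) + ⟪u, v⟫`. -/
def Dom1 (Q : QuadForm H) : Type _ := Q.domain

variable (Q : QuadForm H)

instance : AddCommGroup Q.Dom1 := inferInstanceAs (AddCommGroup Q.domain)

instance : Module ℝ Q.Dom1 := inferInstanceAs (Module ℝ Q.domain)

/-- The inclusion of the form domain into the ambient Hilbert space. -/
def incl : Q.Dom1 →ₗ[ℝ] H := Q.domain.subtype

/-- The bilinear form on the form domain. -/
def bilin : Q.Dom1 →ₗ[ℝ] Q.Dom1 →ₗ[ℝ] ℝ := Q.form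

@[reducible]
def dom1Core : InnerProductSpace.Core ℝ Q.Dom1 where
  inner u v := Q.bilin u v + inner ℝ (Q.incl u) (Q.incl v)
  conj_inner_symm u v := by
    have h : Q.bilin v u = Q.bilin u v := Q.symm v u
    simp [h, real_inner_comm]
  re_inner_nonneg u := by
    have h : 0 ≤ Q.bilin u u := Q.nonneg u
    simpa using add_nonneg h (real_inner_self_nonneg (x := Q.incl u))
  add_left u v w := by
    simp only [map_add, LinearMap.add_apply, inner_add_left]
    ring
  smul_left u v r := by
    simp only [map_smul, LinearMap.smul_apply, inner_smul_left, smul_eq_mul, conj_trivial]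
    ring
  definite u hu := by
    have h : 0 ≤ Q.bilin u u := Q.nonneg u
    have h' := real_inner_self_nonneg (x := Q.incl u)
    have h0 : inner ℝ (Q.incl u) (Q.incl u) = 0 := by
      change Q.bilin u u + inner ℝ (Q.incl u) (Q.incl u) = 0 at hu
      linarith
    exact Subtype.ext (inner_self_eq_zero.mp h0)

instance : NormedAddCommGroup Q.Dom1 := Q.dom1Core.toNormedAddCommGroup

instance : InnerProductSpace ℝ Q.Dom1 := InnerProductSpace.ofCore Q.dom1Core.toCore

theorem inner_dom1 (u v : Q.Dom1) :
    inner ℝ u v = Q.bilin u v + inner ℝ (Q.incl u) (Q.incl v) := rfl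

theorem norm_incl_le (u : Q.Dom1) : ‖Q.incl u‖ ≤ ‖u‖ := by
  have h : 0 ≤ Q.bilin u u := Q.nonneg u
  have h1 := Q.inner_dom1 u u
  rw [real_inner_self_eq_norm_sq, real_inner_self_eq_norm_sq] at h1
  exact abs_le_of_sq_le_sq' (by linarith) (norm_nonneg u) |>.2

theorem incl_injective : Function.Injective Q.incl := Subtype.val_injective

/-- A form is closed if its domain is complete for the norm `Q₁^{1/2}`. -/
def IsClosed : Prop := CompleteSpace Q.Dom1

/-- The domain of the form is dense. -/
def IsDense : Prop := Dense (Q.domain : Set H)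

/-- Transport of a form along a unitary operator `ι : G → H`: the domain is `ι⁻¹ D(Q)` and
`(u, v) ↦ Q(ι u, ι v)`. -/
def comap (ι : G ≃ₗᵢ[ℝ] H) : QuadForm G where
  domain := Q.domain.comap (ι.toLinearEquiv : G →ₗ[ℝ] H)
  form := Q.form.compl₁₂
    ((ι.toLinearEquiv : G →ₗ[ℝ] H).restrict fun _ h => h)
    ((ι.toLinearEquiv : G →ₗ[ℝ] H).restrict fun _ h => h)
  symm _ _ := Q.symm _ _
  nonneg _ := Q.nonneg _

/-- `T` is the semigroup associated with the form `Q`: a strongly continuous contraction semigroup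
whose generator `L` is the operator of the form, that is, `u ∈ D(L)` and `L u = w` if and only if
`u ∈ D(Q)` and `Q(u, v) = ⟪-w, v⟫` for all `v ∈ D(Q)`. -/
structure IsSemigroup (T : ℝ≥0 → H →L[ℝ] H) : Prop where
  zero : T 0 = ContinuousLinearMap.id ℝ H
  add : ∀ s t, T (s + t) = (T s).comp (T t)
  contraction : ∀ t, ‖T t‖ ≤ 1
  continuous : ∀ u, Continuous fun t => T t u
  generator : ∀ u w : H,
    Tendsto (fun t : ℝ≥0 => (t : ℝ)⁻¹ • (T t u - u)) (𝓝[>] 0) (𝓝 w) ↔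
      ∃ hu : u ∈ Q.domain, ∀ v : Q.domain, Q.form ⟨u, hu⟩ v = inner ℝ (-w) (v : H)

/-- The operator `U` intertwines the forms `Q` and `R`: `U D(Q) = D(R)` and
`R(U f, U g) = Q(f, g)` for all `f, g ∈ D(Q)`. -/
structure Intertwines (Q : QuadForm H) (R : QuadForm G) (U : H →L[ℝ] G) : Prop where
  map_domain : Q.domain.map (U : H →ₗ[ℝ] G) = R.domain
  form_eq : ∀ (f g : Q.domain) (hf : U f ∈ R.domain) (hg : U g ∈ R.domain),
    R.form ⟨U f, hf⟩ ⟨U g, hg⟩ = Q.form f g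

end QuadForm

/-- A (symmetric) Dirichlet form on `L²(μ)`: a densely defined closed form such that the unit
contraction `g = f⁺ ∧ 1` operates on its domain and does not increase the form. -/
structure IsDirichletForm {X : Type*} [MeasurableSpace X] {μ : Measure X}
    (E : QuadForm (Lp ℝ 2 μ)) : Prop where
  dense : E.IsDense
  closed : E.IsClosed
  markov : ∀ (f : E.domain) (g : Lp ℝ 2 μ),
    (g =ᵐ[μ] fun x => min (max ((f : Lp ℝ 2 μ) x) 0) 1) →
      ∃ hg : g ∈ E.domain, E.form ⟨g, hg⟩ ⟨g, hg⟩ ≤ E.form f f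

/-- A unitary order isomorphism `L²(μ) → L²(ν)`: a surjective linear isometry which preserves the
order and whose inverse preserves the order. -/
def IsUnitaryOrderIso {X Y : Type*} [MeasurableSpace X] [MeasurableSpace Y] {μ : Measure X}
    {ν : Measure Y} (U : Lp ℝ 2 μ →L[ℝ] Lp ℝ 2 ν) : Prop :=
  ∃ V : Lp ℝ 2 μ ≃ₗᵢ[ℝ] Lp ℝ 2 ν, (∀ f, V f = U f) ∧
    (∀ f, 0 ≤ f → 0 ≤ V f) ∧ ∀ g, 0 ≤ g → 0 ≤ V.symm g

/-! ### Direct integrals of Hilbert spaces -/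

/-- A space `S` of `ν`-measurable vector fields, turning `ζ ↦ H ζ` into a `ν`-measurable field of
Hilbert spaces. (A real function is `ν`-measurable, i.e. measurable for the completion of the
`σ`-algebra, if and only if it is `ν`-a.e. equal to a measurable function.) -/
structure VectorFieldSpace {Z : Type*} [MeasurableSpace Z] (ν : Measure Z) (H : Z → Type*)
    [∀ ζ, NormedAddCommGroup (H ζ)] [∀ ζ, InnerProductSpace ℝ (H ζ)] where
  fields : Submodule ℝ (∀ ζ, H ζ)
  norm_meas : ∀ u ∈ fields, AEMeasurable (fun ζ => ‖u ζ‖) ν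
  mem_of_inner_meas : ∀ v : ∀ ζ, H ζ,
    (∀ u ∈ fields, AEMeasurable (fun ζ => inner ℝ (u ζ) (v ζ)) ν) → v ∈ fields
  fundamental : ∃ u : ℕ → ∀ ζ, H ζ, (∀ n, u n ∈ fields) ∧
    ∀ ζ, (Submodule.span ℝ (Set.range fun n => u n ζ)).topologicalClosure = ⊤

namespace VectorFieldSpace

variable {Z : Type*} [MeasurableSpace Z] {ν : Measure Z} {H : Z → Type*}
  [∀ ζ, NormedAddCommGroup (H ζ)] [∀ ζ, InnerProductSpace ℝ (H ζ)] (S : VectorFieldSpace ν H)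

/-- The square-integrable `ν`-measurable vector fields. -/
def sqInt : Submodule ℝ (∀ ζ, H ζ) where
  carrier := {u | u ∈ S.fields ∧ MemLp (fun ζ => ‖u ζ‖) 2 ν}
  zero_mem' := ⟨S.fields.zero_mem, by simp⟩
  add_mem' := by
    rintro u v ⟨hu, hu'⟩ ⟨hv, hv'⟩
    have h := S.fields.add_mem hu hv
    refine ⟨h, (hu'.add hv').mono (S.norm_meas _ h).aestronglyMeasurable (ae_of_all _ fun ζ => ?_)⟩
    simp only [Pi.add_apply, Real.norm_eq_abs, abs_norm]
    exact (norm_add_le (u ζ) (v ζ)).trans (le_abs_self _)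
  smul_mem' := by
    rintro c u ⟨hu, hu'⟩
    refine ⟨S.fields.smul_mem c hu, ?_⟩
    simpa [norm_smul] using hu'.const_mul |c|

/-- The space of square-integrable vector fields, as a type carrying the semi-inner product
`∫ ⟪u ζ, v ζ⟫ dν(ζ)`. -/
def SqInt : Type _ := S.sqInt

instance : AddCommGroup S.SqInt := inferInstanceAs (AddCommGroup S.sqInt)

instance : Module ℝ S.SqInt := inferInstanceAs (Module ℝ S.sqInt)

/-- The vector field underlying an element of `S.SqInt`. -/
def toField : S.SqInt →ₗ[ℝ] ∀ ζ, H ζ := S.sqInt.subtype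

theorem toField_mem (u : S.SqInt) : S.toField u ∈ S.fields := (Subtype.property u).1

theorem memLp_norm (u : S.SqInt) : MemLp (fun ζ => ‖S.toField u ζ‖) 2 ν := (Subtype.property u).2

theorem aemeasurable_inner {u v : ∀ ζ, H ζ} (hu : u ∈ S.fields) (hv : v ∈ S.fields) :
    AEMeasurable (fun ζ => inner ℝ (u ζ) (v ζ)) ν := by
  have h1 := S.norm_meas _ (S.fields.add_mem hu hv)
  have h2 := S.norm_meas _ hu
  have h3 := S.norm_meas _ hv
  have : (fun ζ => inner ℝ (u ζ) (v ζ)) = fun ζ =>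
      (‖(u + v) ζ‖ * ‖(u + v) ζ‖ - ‖u ζ‖ * ‖u ζ‖ - ‖v ζ‖ * ‖v ζ‖) / 2 := by
    funext ζ
    exact real_inner_eq_norm_add_mul_self_sub_norm_mul_self_sub_norm_mul_self_div_two _ _
  rw [this]
  exact (((h1.mul h1).sub (h2.mul h2)).sub (h3.mul h3)).div_const 2

theorem integrable_inner (u v : S.SqInt) :
    Integrable (fun ζ => inner ℝ (S.toField u ζ) (S.toField v ζ)) ν := by
  refine ((S.memLp_norm u).integrable_mul (S.memLp_norm v)).mono
    (S.aemeasurable_inner (S.toField_mem u) (S.toField_mem v)).aestronglyMeasurable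
    (ae_of_all _ fun ζ => ?_)
  simpa using abs_real_inner_le_norm (S.toField u ζ) (S.toField v ζ)

@[reducible]
def sqIntCore : PreInnerProductSpace.Core ℝ S.SqInt where
  inner u v := ∫ ζ, inner ℝ (S.toField u ζ) (S.toField v ζ) ∂ν
  conj_inner_symm u v := by simp [real_inner_comm]
  re_inner_nonneg u := by
    exact integral_nonneg fun ζ => real_inner_self_nonneg (x := S.toField u ζ)
  add_left u v w := by
    simp only [map_add, Pi.add_apply, inner_add_left]
    exact integral_add (S.integrable_inner u w) (S.integrable_inner v w)
  smul_left u v r := by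
    simp only [map_smul, Pi.smul_apply, inner_smul_left, integral_const_mul]

instance : SeminormedAddCommGroup S.SqInt :=
  @InnerProductSpace.Core.toSeminormedAddCommGroup ℝ _ _ _ _ S.sqIntCore

instance : InnerProductSpace ℝ S.SqInt := InnerProductSpace.ofCore S.sqIntCore

theorem inner_sqInt (u v : S.SqInt) :
    inner ℝ u v = ∫ ζ, inner ℝ (S.toField u ζ) (S.toField v ζ) ∂ν := rfl

/-- The direct integral `∫ H ζ dν(ζ)` with underlying space `S`: square-integrable vector fields
modulo those at distance zero. -/
abbrev DirectIntegral : Type _ := SeparationQuotient S.SqInt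

/-- The class of a square-integrable vector field. -/
def cls (u : ∀ ζ, H ζ) (hu : u ∈ S.sqInt) : S.DirectIntegral :=
  SeparationQuotient.mk (show S.SqInt from ⟨u, hu⟩)

theorem mk_eq_mk_iff (u v : S.SqInt) :
    (SeparationQuotient.mk u : S.DirectIntegral) = SeparationQuotient.mk v ↔
      ∀ᵐ ζ ∂ν, S.toField u ζ = S.toField v ζ := by
  rw [SeparationQuotient.mk_eq_mk, Metric.inseparable_iff, dist_eq_norm, ← sq_eq_zero_iff,
    ← real_inner_self_eq_norm_sq, inner_sqInt, integral_eq_zero_iff_of_nonneg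
      (fun ζ => real_inner_self_nonneg) (S.integrable_inner _ _)]
  refine ⟨fun h => h.mono fun ζ hζ => ?_, fun h => h.mono fun ζ hζ => ?_⟩
  · have h0 := inner_self_eq_zero.mp hζ
    rw [map_sub] at h0
    exact sub_eq_zero.mp h0
  · have h0 : S.toField (u - v) ζ = 0 := by
      rw [map_sub]
      exact sub_eq_zero.mpr hζ
    simp [h0]

/-- `B` is the direct integral `∫ U ζ dν(ζ)`: the field `U` of bounded operators is `ν`-measurable
and `ν`-essentially bounded, and `B` maps the class of `u` to the class of `ζ ↦ U ζ (u ζ)`. -/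
structure IsDirectIntegralOp {H' : Z → Type*} [∀ ζ, NormedAddCommGroup (H' ζ)]
    [∀ ζ, InnerProductSpace ℝ (H' ζ)] (S : VectorFieldSpace ν H) (S' : VectorFieldSpace ν H')
    (U : ∀ ζ, H ζ →L[ℝ] H' ζ) (B : S.DirectIntegral →L[ℝ] S'.DirectIntegral) : Prop where
  measurable : ∀ u ∈ S.fields, (fun ζ => U ζ (u ζ)) ∈ S'.fields
  bounded : ∃ C : ℝ, ∀ᵐ ζ ∂ν, ‖U ζ‖ ≤ C
  apply_cls : ∀ (u : ∀ ζ, H ζ) (hu : u ∈ S.sqInt),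
    ∃ hv : (fun ζ => U ζ (u ζ)) ∈ S'.sqInt, B (S.cls u hu) = S'.cls _ hv

end VectorFieldSpace

/-! ### Direct integrals of quadratic forms -/

/-- A `ν`-measurable field of (densely defined, closed) quadratic forms `ζ ↦ form ζ` on `H ζ`. -/
structure FormField {Z : Type*} [MeasurableSpace Z] (ν : Measure Z) (H : Z → Type*)
    [∀ ζ, NormedAddCommGroup (H ζ)] [∀ ζ, InnerProductSpace ℝ (H ζ)] where
  form : ∀ ζ, QuadForm (H ζ)
  dense : ∀ ζ, (form ζ).IsDense
  closed : ∀ ζ, (form ζ).IsClosed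
  SH : VectorFieldSpace ν H
  SQ : VectorFieldSpace ν fun ζ => (form ζ).Dom1
  SQ_sub_SH : ∀ u ∈ SQ.fields, (fun ζ => (form ζ).incl (u ζ)) ∈ SH.fields

namespace FormField

variable {Z : Type*} [MeasurableSpace Z] {ν : Measure Z} {H : Z → Type*}
  [∀ ζ, NormedAddCommGroup (H ζ)] [∀ ζ, InnerProductSpace ℝ (H ζ)] (F : FormField ν H)

theorem incl_mem_sqInt (u : F.SQ.SqInt) :
    (fun ζ => (F.form ζ).incl (F.SQ.toField u ζ)) ∈ F.SH.sqInt := by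
  have h := F.SQ_sub_SH _ (F.SQ.toField_mem u)
  refine ⟨h, (F.SQ.memLp_norm u).mono (F.SH.norm_meas _ h).aestronglyMeasurable
    (ae_of_all _ fun ζ => ?_)⟩
  simpa using (F.form ζ).norm_incl_le (F.SQ.toField u ζ)

/-- The map sending `u ∈ S_Q` with `∫ Q_{ζ,1}(u ζ) dν(ζ) < ∞` to its class in the direct integral
of `ζ ↦ H ζ`. -/
def inclDI : F.SQ.SqInt →ₗ[ℝ] F.SH.DirectIntegral where
  toFun u := F.SH.cls _ (F.incl_mem_sqInt u)
  map_add' u v := by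
    refine (congrArg SeparationQuotient.mk ?_).trans (SeparationQuotient.mk_add _ _)
    refine Subtype.ext (funext fun ζ => ?_)
    change (F.form ζ).incl (F.SQ.toField (u + v) ζ) =
      (F.form ζ).incl (F.SQ.toField u ζ) + (F.form ζ).incl (F.SQ.toField v ζ)
    rw [map_add, Pi.add_apply, map_add]
  map_smul' c u := by
    refine (congrArg SeparationQuotient.mk ?_).trans (SeparationQuotient.mk_smul c _)
    refine Subtype.ext (funext fun ζ => ?_)
    change (F.form ζ).incl (F.SQ.toField (c • u) ζ) = c • (F.form ζ).incl (F.SQ.toField u ζ)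
    rw [map_smul, Pi.smul_apply, map_smul]

theorem ae_eq_of_inclDI_eq {u v : F.SQ.SqInt} (h : F.inclDI u = F.inclDI v) :
    ∀ᵐ ζ ∂ν, F.SQ.toField u ζ = F.SQ.toField v ζ :=
  ((F.SH.mk_eq_mk_iff _ _).mp h).mono fun ζ hζ => (F.form ζ).incl_injective hζ

theorem integrable_bilin (u v : F.SQ.SqInt) :
    Integrable (fun ζ => (F.form ζ).bilin (F.SQ.toField u ζ) (F.SQ.toField v ζ)) ν := by
  have h1 := F.SQ.integrable_inner u v
  have h2 := F.SH.integrable_inner (show F.SH.SqInt from ⟨_, F.incl_mem_sqInt u⟩)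
    (show F.SH.SqInt from ⟨_, F.incl_mem_sqInt v⟩)
  refine (h1.sub h2).congr (ae_of_all _ fun ζ => ?_)
  change inner ℝ (F.SQ.toField u ζ) (F.SQ.toField v ζ) -
    inner ℝ ((F.form ζ).incl (F.SQ.toField u ζ)) ((F.form ζ).incl (F.SQ.toField v ζ)) = _
  rw [QuadForm.inner_dom1, add_sub_cancel_right]

/-- A representative in `S_Q` of an element of the domain of the direct integral form. -/
def rep (u : LinearMap.range F.inclDI) : F.SQ.SqInt := Classical.choose u.2

theorem inclDI_rep (u : LinearMap.range F.inclDI) : F.inclDI (F.rep u) = u :=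
  Classical.choose_spec u.2

theorem rep_add (u v : LinearMap.range F.inclDI) :
    ∀ᵐ ζ ∂ν, F.SQ.toField (F.rep (u + v)) ζ =
      F.SQ.toField (F.rep u) ζ + F.SQ.toField (F.rep v) ζ := by
  have h := F.ae_eq_of_inclDI_eq (u := F.rep (u + v)) (v := F.rep u + F.rep v) (by
    rw [map_add, inclDI_rep, inclDI_rep, inclDI_rep, Submodule.coe_add])
  simpa only [map_add, Pi.add_apply] using h

theorem rep_smul (c : ℝ) (u : LinearMap.range F.inclDI) :
    ∀ᵐ ζ ∂ν, F.SQ.toField (F.rep (c • u)) ζ = c • F.SQ.toField (F.rep u) ζ := by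
  have h := F.ae_eq_of_inclDI_eq (u := F.rep (c • u)) (v := c • F.rep u) (by
    rw [map_smul, inclDI_rep, inclDI_rep, Submodule.coe_smul])
  simpa only [map_smul, Pi.smul_apply] using h

/-- The direct integral form `∫ Q_ζ dν(ζ)` on the direct integral of `ζ ↦ H ζ`: its domain consists
of the classes of those `û ∈ S_Q` with `∫ Q_{ζ,1}(û ζ) dν(ζ) < ∞`, and
`Q(u, v) = ∫ Q_ζ(û ζ, v̂ ζ) dν(ζ)`. -/
def directIntegral : QuadForm F.SH.DirectIntegral where
  domain := LinearMap.range F.inclDI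
  form := LinearMap.mk₂ ℝ
    (fun u v => ∫ ζ, (F.form ζ).bilin (F.SQ.toField (F.rep u) ζ) (F.SQ.toField (F.rep v) ζ) ∂ν)
    (fun u u' v => by
      rw [← integral_add (F.integrable_bilin _ _) (F.integrable_bilin _ _)]
      refine integral_congr_ae ((F.rep_add u u').mono fun ζ hζ => ?_)
      simp only [hζ, map_add, LinearMap.add_apply])
    (fun c u v => by
      rw [smul_eq_mul, ← integral_const_mul]
      refine integral_congr_ae ((F.rep_smul c u).mono fun ζ hζ => ?_)
      simp only [hζ, map_smul, LinearMap.smul_apply, smul_eq_mul])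
    (fun u v v' => by
      rw [← integral_add (F.integrable_bilin _ _) (F.integrable_bilin _ _)]
      refine integral_congr_ae ((F.rep_add v v').mono fun ζ hζ => ?_)
      simp only [hζ, map_add])
    (fun c u v => by
      rw [smul_eq_mul, ← integral_const_mul]
      refine integral_congr_ae ((F.rep_smul c v).mono fun ζ hζ => ?_)
      simp only [hζ, map_smul, smul_eq_mul])
  symm _ _ := integral_congr_ae (ae_of_all _ fun ζ => (F.form ζ).symm _ _)
  nonneg _ := integral_nonneg fun ζ => (F.form ζ).nonneg _

/-- The direct integral form may be computed with arbitrary representatives in `S_Q`. -/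
theorem directIntegral_form_apply (u v : F.SQ.SqInt) :
    F.directIntegral.form ⟨F.inclDI u, ⟨u, rfl⟩⟩ ⟨F.inclDI v, ⟨v, rfl⟩⟩ =
      ∫ ζ, (F.form ζ).bilin (F.SQ.toField u ζ) (F.SQ.toField v ζ) ∂ν := by
  have h1 := F.ae_eq_of_inclDI_eq (F.inclDI_rep ⟨F.inclDI u, ⟨u, rfl⟩⟩)
  have h2 := F.ae_eq_of_inclDI_eq (F.inclDI_rep ⟨F.inclDI v, ⟨v, rfl⟩⟩)
  refine integral_congr_ae ((h1.and h2).mono fun ζ hζ => ?_)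
  exact congrArg₂ (fun a b => (F.form ζ).bilin a b) hζ.1 hζ.2

end FormField

/-! ### Disintegrations -/

/-- `κ` is a pseudo-disintegration of `μ` over `ν`. -/
structure IsPseudoDisintegration {X Z : Type*} [MeasurableSpace X] [MeasurableSpace Z]
    (μ : Measure X) (ν : Measure Z) (κ : Z → Measure X) : Prop where
  ne_zero : ∀ ζ, κ ζ ≠ 0
  meas : ∀ A, MeasurableSet A → AEMeasurable (fun ζ => κ ζ A) ν
  eq_lintegral : ∀ A, MeasurableSet A → μ A = ∫⁻ ζ, κ ζ A ∂ν

/-- `A` is a separating family for `κ`: pairwise disjoint `μ`-measurable sets such that `A ζ` is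
`κ ζ`-conegligible for `ν`-a.e. `ζ`. -/
structure IsSeparatingFamily {X Z : Type*} [MeasurableSpace X] [MeasurableSpace Z]
    (μ : Measure X) (ν : Measure Z) (κ : Z → Measure X) (A : Z → Set X) : Prop where
  disjoint : Pairwise fun ζ ξ => Disjoint (A ζ) (A ξ)
  meas : ∀ ζ, NullMeasurableSet (A ζ) μ
  conegligible : ∀ᵐ ζ ∂ν, κ ζ (A ζ)ᶜ = 0

open Classical in
/-- The diagonal embedding: `δ(f)_ζ` is the `κ ζ`-class of `f` if `f ∈ 𝓛²(κ ζ)`, and `0`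
otherwise. -/
def diagEmb {X Z : Type*} [MeasurableSpace X] (κ : Z → Measure X) (f : X → ℝ) (ζ : Z) :
    Lp ℝ 2 (κ ζ) :=
  if h : MemLp f 2 (κ ζ) then h.toLp f else 0

/-- `ι : L²(μ) → ∫ L²(κ ζ) dν(ζ)` is the canonical map `[f] ↦ [δ(f)]`. -/
def IsCanonicalIso {X Z : Type*} [MeasurableSpace X] [MeasurableSpace Z] (μ : Measure X)
    {ν : Measure Z} {κ : Z → Measure X} (S : VectorFieldSpace ν fun ζ => Lp ℝ 2 (κ ζ))
    (ι : Lp ℝ 2 μ ≃ₗᵢ[ℝ] S.DirectIntegral) : Prop :=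
  ∀ (f : X → ℝ) (hf : MemLp f 2 μ),
    ∃ h : diagEmb κ f ∈ S.sqInt, ι (hf.toLp f) = S.cls _ h

/-- The field `F` of forms on `L²(κ ζ)` is compatible with the pseudo-disintegration `κ` of `μ`:
there is a linear space `𝒜 ⊆ 𝓛²(μ)` with dense `μ`-classes such that the underlying space of
measurable vector fields is the one generated by `δ(𝒜)`, that is, the (unique) space of measurable
vector fields in `∏ L²(κ ζ)` containing `δ(𝒜)`; a field in `∏ D(Q_ζ)` belongs to `S_Q` if and only
if it belongs to that space; and `𝒜 ⊆ D(Q)` for the direct integral form `Q`. -/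
def IsCompatible {X Z : Type*} [MeasurableSpace X] [MeasurableSpace Z] (μ : Measure X)
    {ν : Measure Z} {κ : Z → Measure X} (F : FormField ν fun ζ => Lp ℝ 2 (κ ζ)) : Prop :=
  ∃ 𝒜 : Submodule ℝ (X → ℝ),
    (∀ f ∈ 𝒜, MemLp f 2 μ) ∧
    Dense {g : Lp ℝ 2 μ | ∃ f ∈ 𝒜, g =ᵐ[μ] f} ∧
    (∀ f ∈ 𝒜, diagEmb κ f ∈ F.SH.fields) ∧
    (∀ u : ∀ ζ, (F.form ζ).Dom1,
      u ∈ F.SQ.fields ↔ (fun ζ => (F.form ζ).incl (u ζ)) ∈ F.SH.fields) ∧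
    ∀ f ∈ 𝒜, ∃ h : diagEmb κ f ∈ F.SH.sqInt, F.SH.cls _ h ∈ F.directIntegral.domain

end

/-! The forms are compared through their generators. A unitary that intertwines two semigroups
intertwines their generators. On the domain of a generator `L` the squared form norm is `⟪u - L u,
u⟫`, and this domain is a core of the closed form; hence the unitary restricts to an isometry
between the form domains (`QuadForm.IsClosed.exists_dom1_isometry`). This applies to `U ζ` and to
its inverse in almost every fiber. By compatibility a field in the form domains is measurable as
soon as it is measurable in the ambient spaces, so the fiberwise isometries need not be chosen
measurably, and integration over `ν` gives the intertwining of the direct integral forms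
(`FormField.directIntegral_intertwines`).

The canonical map is isometric because `∫ f² dμ` disintegrates. It is onto because of separation:
multiplying `f` by the indicator of `s⁻¹ B` multiplies `δ(f)` by the indicator of `B`. A field
orthogonal to the image is therefore orthogonal, in almost every fiber, to one countable total
family of indicators (`IsPseudoDisintegration.ae_eq_zero_of_orthogonal`). Positivity of `f` is
positivity of `δ(f)_ζ` for almost every `ζ`, so order also passes from the fibers to `L²(μ)`.

The semigroups on `L²(μ)` are intertwined because a form determines its semigroup
(`QuadForm.IsSemigroup.unique`) and conjugation by the unitary turns a semigroup of one form into a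
semigroup of the other. -/

/-! ### Semigroups of forms: uniqueness and conjugation. -/

namespace QuadForm

variable {H : Type*} [NormedAddCommGroup H] [InnerProductSpace ℝ H]
variable {G : Type*} [NormedAddCommGroup G] [InnerProductSpace ℝ G]

/-- `u` belongs to the domain of the operator `L` of the form `Q`, and `L u = w`. -/
def IsGen (Q : QuadForm H) (u w : H) : Prop :=
  ∃ hu : u ∈ Q.domain, ∀ v : Q.domain, Q.form ⟨u, hu⟩ v = inner ℝ (-w) (v : H)

theorem IsGen.sub {Q : QuadForm H} {u w u' w' : H} (h : Q.IsGen u w) (h' : Q.IsGen u' w') :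
    Q.IsGen (u - u') (w - w') := by
  obtain ⟨hu, h⟩ := h
  obtain ⟨hu', h'⟩ := h'
  refine ⟨Q.domain.sub_mem hu hu', fun v => ?_⟩
  have e : (⟨u - u', Q.domain.sub_mem hu hu'⟩ : Q.domain) = ⟨u, hu⟩ - ⟨u', hu'⟩ := rfl
  rw [e, map_sub, LinearMap.sub_apply, h, h', ← inner_sub_left]
  congr 1
  abel

/-- Dissipativity, inherited from `Q(u, u) ≥ 0`; this sign drives the uniqueness of the semigroup.
-/
theorem IsGen.inner_nonpos {Q : QuadForm H} {u w : H} (h : Q.IsGen u w) : inner ℝ u w ≤ 0 := by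
  obtain ⟨hu, h⟩ := h
  have h1 := h ⟨u, hu⟩
  have h2 := Q.nonneg ⟨u, hu⟩
  rw [h1, inner_neg_left, real_inner_comm] at h2
  linarith

namespace IsSemigroup

variable {Q : QuadForm H} {T S : ℝ≥0 → H →L[ℝ] H}

theorem norm_apply_le (hT : Q.IsSemigroup T) (t : ℝ≥0) (u : H) : ‖T t u‖ ≤ ‖u‖ := by
  simpa using (T t).le_of_opNorm_le (hT.contraction t) u

/-- `T t` commutes with the difference quotients of the semigroup and is continuous. -/
theorem isGen_apply (hT : Q.IsSemigroup T) {u w : H} (h : Q.IsGen u w) (t : ℝ≥0) :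
    Q.IsGen (T t u) (T t w) := by
  refine (hT.generator _ _).mp ?_
  have h1 := ((T t).continuous.tendsto w).comp ((hT.generator u w).mpr h)
  refine h1.congr fun r => ?_
  have h2 : T t (T r u) = T r (T t u) := by
    rw [← ContinuousLinearMap.comp_apply, ← hT.add, add_comm, hT.add,
      ContinuousLinearMap.comp_apply]
  simp [h2]

theorem continuous_toNNReal (hT : Q.IsSemigroup T) (u : H) :
    Continuous fun r : ℝ => T r.toNNReal u :=
  (hT.continuous u).comp continuous_real_toNNReal

theorem hasDerivWithinAt (hT : Q.IsSemigroup T) {u w : H} (h : Q.IsGen u w) {r : ℝ}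
    (hr : 0 ≤ r) :
    HasDerivWithinAt (fun r : ℝ => T r.toNNReal u) (T r.toNNReal w) (Set.Ici r) r := by
  rw [hasDerivWithinAt_iff_tendsto_slope, Set.Ici_sdiff_left]
  have h1 := (hT.generator _ _).mpr (hT.isGen_apply h r.toNNReal)
  have h2 : Tendsto (fun x : ℝ => (x - r).toNNReal) (𝓝[>] r) (𝓝[>] 0) := by
    refine tendsto_nhdsWithin_iff.mpr ⟨?_, ?_⟩
    · have : Continuous fun x : ℝ => (x - r).toNNReal := by fun_prop
      have h3 := this.tendsto r
      simp only [sub_self, Real.toNNReal_zero] at h3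
      exact h3.mono_left nhdsWithin_le_nhds
    · filter_upwards [self_mem_nhdsWithin] with x hx
      simpa using hx
  refine (h1.comp h2).congr' ?_
  filter_upwards [self_mem_nhdsWithin] with x hx
  have hx : r < x := hx
  have h4 : x.toNNReal = (x - r).toNNReal + r.toNNReal := by
    rw [← Real.toNNReal_add (by linarith) hr, sub_add_cancel]
  simp only [Function.comp_apply, slope_def_module]
  rw [h4, hT.add, ContinuousLinearMap.comp_apply, Real.coe_toNNReal _ (by linarith)]

/-- Both orbits stay in the domain of the same operator `L`. With `d = T r u - S r u`, the function
`‖d‖²` vanishes at `r = 0` and has right derivative `2 ⟪d, L d⟫ ≤ 0`. -/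
theorem apply_eq_of_isGen (hT : Q.IsSemigroup T) (hS : Q.IsSemigroup S) {u w : H}
    (h : Q.IsGen u w) (t : ℝ≥0) : T t u = S t u := by
  have hc : Continuous fun r : ℝ => ‖T r.toNNReal u - S r.toNNReal u‖ ^ 2 :=
    ((hT.continuous_toNNReal u).sub (hS.continuous_toNNReal u)).norm.pow 2
  have key := image_le_of_deriv_right_le_deriv_boundary (a := 0) (b := t) hc.continuousOn
    (f' := fun r => 2 * inner ℝ (T r.toNNReal u - S r.toNNReal u)
      (T r.toNNReal w - S r.toNNReal w))
    (fun x hx => ((hT.hasDerivWithinAt h hx.1).sub (hS.hasDerivWithinAt h hx.1)).norm_sq)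
    (B := fun _ => 0) (B' := fun _ => 0) (by simp [hT.zero, hS.zero]) continuousOn_const
    (fun x _ => hasDerivWithinAt_const _ _ _)
    (fun x _ => by
      have := ((hT.isGen_apply h x.toNNReal).sub (hS.isGen_apply h x.toNNReal)).inner_nonpos
      linarith)
    (Set.right_mem_Icc.mpr t.2)
  simp only [Real.toNNReal_coe] at key
  have h0 : ‖T t u - S t u‖ = 0 :=
    pow_eq_zero_iff two_ne_zero |>.mp (le_antisymm key (by positivity))
  exact sub_eq_zero.mp (norm_eq_zero.mp h0)

/-- `T t` shifts the interval of integration by `t`, so the difference quotient of the average is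
that of `∫_0^{ε+t} - ∫_0^t` at `t = 0`, and the fundamental theorem of calculus gives the limit. -/
theorem isGen_average [CompleteSpace H] (hT : Q.IsSemigroup T) (u : H) {ε : ℝ} (hε : 0 < ε) :
    Q.IsGen (∫ r in (0 : ℝ)..ε, T r.toNNReal u) (T ε.toNNReal u - u) := by
  refine (hT.generator _ _).mp ?_
  have hc := hT.continuous_toNNReal u
  set g : ℝ → H := fun r => T r.toNNReal u with hg
  have hi : ∀ a b, IntervalIntegrable g volume a b := fun a b => hc.intervalIntegrable a b
  have hd : ∀ x, HasDerivAt (fun x => ∫ r in (0 : ℝ)..x, g r) (g x) x := fun x =>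
    intervalIntegral.integral_hasDerivAt_right (hi 0 x)
      hc.aestronglyMeasurable.stronglyMeasurableAtFilter hc.continuousAt
  have h1 : HasDerivAt (fun h => (∫ r in (0 : ℝ)..(ε + h), g r) - ∫ r in (0 : ℝ)..h, g r)
      (g ε - g 0) 0 := by
    refine HasDerivAt.sub ?_ (hd 0)
    have := hd (ε + 0)
    simpa using this.comp_const_add ε 0
  have h2 := h1.hasDerivWithinAt (s := Set.Ici 0)
  rw [hasDerivWithinAt_iff_tendsto_slope, Set.Ici_sdiff_left] at h2
  have h3 : Tendsto (fun t : ℝ≥0 => (t : ℝ)) (𝓝[>] 0) (𝓝[>] 0) := by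
    refine tendsto_nhdsWithin_iff.mpr ⟨?_, ?_⟩
    · have := NNReal.continuous_coe.tendsto 0
      exact this.mono_left nhdsWithin_le_nhds
    · filter_upwards [self_mem_nhdsWithin] with x hx
      exact_mod_cast hx
  have h4 : g 0 = u := by simp [hg, hT.zero]
  rw [h4] at h2
  refine (h2.comp h3).congr fun t => ?_
  simp only [Function.comp_apply, slope_def_module, sub_zero, add_zero,
    intervalIntegral.integral_same]
  congr 1
  have h5 : T t (∫ r in (0 : ℝ)..ε, g r) = ∫ r in (0 : ℝ)..ε, g (r + t) := by
    rw [← ContinuousLinearMap.intervalIntegral_comp_comm _ (hi _ _)]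
    refine intervalIntegral.integral_congr fun r hr => ?_
    rw [Set.uIcc_of_le hε.le] at hr
    simp only [hg]
    rw [Real.toNNReal_add hr.1 t.coe_nonneg, add_comm, hT.add, ContinuousLinearMap.comp_apply,
      Real.toNNReal_coe]
  rw [h5, intervalIntegral.integral_comp_add_right, zero_add, sub_left_inj,
    intervalIntegral.integral_interval_sub_left (hi _ _) (hi _ _)]

/-- The averages `x⁻¹ ∫_0^x T r u dr` lie in the domain of the generator and tend to `u` as `x`
decreases to `0`. -/
theorem dense_isGen [CompleteSpace H] (hT : Q.IsSemigroup T) :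
    Dense {u : H | ∃ w, Q.IsGen u w} := by
  intro u
  have hc := hT.continuous_toNNReal u
  have hd : HasDerivAt (fun x => ∫ r in (0 : ℝ)..x, T r.toNNReal u) (T (0 : ℝ).toNNReal u) 0 :=
    intervalIntegral.integral_hasDerivAt_right (hc.intervalIntegrable _ _)
      hc.aestronglyMeasurable.stronglyMeasurableAtFilter hc.continuousAt
  have h2 := hd.hasDerivWithinAt (s := Set.Ici 0)
  rw [hasDerivWithinAt_iff_tendsto_slope, Set.Ici_sdiff_left] at h2
  simp only [Real.toNNReal_zero, hT.zero, ContinuousLinearMap.id_apply] at h2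
  refine mem_closure_of_tendsto h2 ?_
  filter_upwards [self_mem_nhdsWithin] with x hx
  obtain ⟨hu, h⟩ := hT.isGen_average u hx
  simp only [slope_def_module, sub_zero, intervalIntegral.integral_same]
  refine ⟨x⁻¹ • (T x.toNNReal u - u), Q.domain.smul_mem _ hu, fun v => ?_⟩
  have := (Q.form.map_smul x⁻¹ ⟨_, hu⟩)
  rw [← smul_neg, real_inner_smul_left, ← h v]
  exact congrArg (fun l => l v) this

/-- The semigroup of a form is unique. -/
theorem unique [CompleteSpace H] (hT : Q.IsSemigroup T) (hS : Q.IsSemigroup S) : T = S := by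
  funext t
  refine ContinuousLinearMap.ext fun u => ?_
  refine congrFun (Continuous.ext_on hT.dense_isGen (T t).continuous (S t).continuous ?_) u
  rintro u ⟨w, h⟩
  exact hT.apply_eq_of_isGen hS h t

end IsSemigroup

theorem Intertwines.isGen {Q : QuadForm H} {R : QuadForm G} {V : H ≃ₗᵢ[ℝ] G} {U : H →L[ℝ] G}
    (hVU : ∀ f, V f = U f) (h : Q.Intertwines R U) {u w : H} :
    R.IsGen (V u) (V w) ↔ Q.IsGen u w := by
  have hmem : ∀ f, V f ∈ R.domain ↔ f ∈ Q.domain := by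
    intro f
    rw [← h.map_domain]
    constructor
    · rintro ⟨g, hg, e⟩
      have : V g = V f := (hVU g).trans e
      exact V.injective this ▸ hg
    · exact fun hf => ⟨f, hf, (hVU f).symm⟩
  have hform : ∀ (f g : Q.domain) (hf : V f ∈ R.domain) (hg : V g ∈ R.domain),
      R.form ⟨V f, hf⟩ ⟨V g, hg⟩ = Q.form f g := by
    intro f g
    simp only [hVU]
    exact h.form_eq f g
  constructor
  · rintro ⟨hu, h1⟩
    refine ⟨(hmem u).mp hu, fun v => ?_⟩
    have := h1 ⟨V v, (hmem v).mpr v.2⟩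
    rw [hform ⟨u, (hmem u).mp hu⟩ v] at this
    rw [this, ← map_neg, V.inner_map_map]
  · rintro ⟨hu, h1⟩
    refine ⟨(hmem u).mpr hu, fun v => ?_⟩
    have hv : V (V.symm v) = v := V.apply_symm_apply v
    have hv' : V.symm v ∈ Q.domain := by rw [← hmem, hv]; exact v.2
    have := hform ⟨u, hu⟩ ⟨V.symm v, hv'⟩ ((hmem u).mpr hu) ((hmem _).mpr hv')
    rw [h1, ← V.inner_map_map] at this
    simp only [hv, map_neg] at this
    exact this

/-- Unitary operators which intertwine two forms intertwine their semigroups. -/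
theorem Intertwines.semigroup [CompleteSpace G] {Q : QuadForm H} {R : QuadForm G}
    {V : H ≃ₗᵢ[ℝ] G} {U : H →L[ℝ] G} (hVU : ∀ f, V f = U f) (h : Q.Intertwines R U)
    {P : ℝ≥0 → H →L[ℝ] H} {S : ℝ≥0 → G →L[ℝ] G} (hP : Q.IsSemigroup P) (hS : R.IsSemigroup S)
    (t : ℝ≥0) : (S t).comp U = U.comp (P t) := by
  let V' : G →L[ℝ] H := (V.symm.toContinuousLinearEquiv : G →L[ℝ] H)
  let W : H →L[ℝ] G := (V.toContinuousLinearEquiv : H →L[ℝ] G)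
  -- The conjugated semigroup has the operator of `R` as generator, since `V` carries the operator
  -- of `Q` onto that of `R`; uniqueness then identifies it with `S`.
  have hT : R.IsSemigroup fun t => W.comp ((P t).comp V') := by
    refine ⟨?_, fun r t => ?_, fun t => ?_, fun u => ?_, fun u w => ?_⟩
    · ext u
      simp [hP.zero, W, V']
    · ext u
      simp [hP.add, W, V']
    · refine ContinuousLinearMap.opNorm_le_bound _ zero_le_one fun u => ?_
      simpa [W, V'] using hP.norm_apply_le t (V.symm u)
    · exact W.continuous.comp (hP.continuous _)
    · obtain ⟨u, rfl⟩ := V.surjective u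
      obtain ⟨w, rfl⟩ := V.surjective w
      refine Iff.trans ?_ ((hP.generator u w).trans (h.isGen hVU).symm)
      rw [V.toHomeomorph.isInducing.tendsto_nhds_iff]
      refine iff_of_eq (congrArg (fun f => Tendsto f _ _) (funext fun t => ?_))
      simp [W, V']
  have e := hT.unique hS
  ext u
  rw [← e]
  simp [W, V', ← hVU]

end QuadForm

/-! ### Closed forms: the generator domain as a core. -/

namespace QuadForm

variable {H : Type*} [NormedAddCommGroup H] [InnerProductSpace ℝ H]
variable {G : Type*} [NormedAddCommGroup G] [InnerProductSpace ℝ G]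

/-- The inclusion of the form domain as a continuous linear map. -/
noncomputable def inclL (Q : QuadForm H) : Q.Dom1 →L[ℝ] H :=
  Q.incl.mkContinuous 1 fun u => by simpa using Q.norm_incl_le u

/-- The domain of the operator of a closed form is a form core. -/
theorem IsClosed.dense_isGen [CompleteSpace H] {Q : QuadForm H} (hQ : Q.IsClosed) :
    Dense {u : Q.Dom1 | ∃ w, Q.IsGen (Q.incl u) w} := by
  have : CompleteSpace Q.Dom1 := hQ
  -- The adjoint `j*` of the inclusion `j` plays the role of `(1 - L)⁻¹`. A vector `u` orthogonal to
  -- its range satisfies `⟪j u, j u⟫ = Q₁(j* j u, u) = 0`, so the range is dense.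
  have hK : (LinearMap.range (Q.inclL.adjoint : H →ₗ[ℝ] Q.Dom1)).topologicalClosure = ⊤ := by
    rw [Submodule.topologicalClosure_eq_top_iff]
    refine (Submodule.eq_bot_iff _).mpr fun u hu => Q.incl_injective ?_
    rw [map_zero, ← inner_self_eq_zero (𝕜 := ℝ)]
    have h1 := (Submodule.mem_orthogonal _ _).mp hu (Q.inclL.adjoint (Q.incl u)) ⟨_, rfl⟩
    rwa [ContinuousLinearMap.adjoint_inner_left] at h1
  have hd := Submodule.dense_iff_topologicalClosure_eq_top.mpr hK
  refine hd.mono ?_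
  rintro _ ⟨w, rfl⟩
  -- `Q₁(j* w, v) = ⟪w, v⟫` says that `L (j* w) = j* w - w`.
  refine ⟨Q.incl (Q.inclL.adjoint w) - w, (Q.inclL.adjoint w : Q.Dom1).2, fun v => ?_⟩
  have h1 := ContinuousLinearMap.adjoint_inner_left Q.inclL (show Q.Dom1 from v) w
  rw [inner_dom1] at h1
  rw [neg_sub, inner_sub_left]
  exact eq_sub_of_add_eq h1

/-- On the generator domain the form norm is expressed by the ambient inner product and the operator
alone, hence is preserved by a unitary that intertwines the operators. -/
theorem norm_sq_dom1_of_isGen {Q : QuadForm H} (u : Q.Dom1) {w : H} (h : Q.IsGen (Q.incl u) w) :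
    ‖u‖ ^ 2 = inner ℝ (Q.incl u - w) (Q.incl u) := by
  obtain ⟨hu, h⟩ := h
  rw [← real_inner_self_eq_norm_sq, inner_dom1, inner_sub_left, sub_eq_neg_add, ← inner_neg_left]
  exact congrArg (· + _) (h (show Q.domain from u))

/-- A unitary operator which intertwines the operators of two closed forms restricts to an isometry
between the form domains. -/
theorem IsClosed.exists_dom1_isometry [CompleteSpace H] {Q : QuadForm H} {R : QuadForm G}
    (hQ : Q.IsClosed) (hR : R.IsClosed) (V : H ≃ₗᵢ[ℝ] G)
    (hV : ∀ u w, Q.IsGen u w → R.IsGen (V u) (V w)) :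
    ∃ J : Q.Dom1 →ₗᵢ[ℝ] R.Dom1, ∀ u, R.incl (J u) = V (Q.incl u) := by
  have : CompleteSpace R.Dom1 := hR
  have key : ∀ u : Q.Dom1, ∃ v : R.Dom1, R.incl v = V (Q.incl u) ∧ ‖v‖ = ‖u‖ := by
    have hnorm : ∀ (u : Q.Dom1) (v : R.Dom1) (w : H), Q.IsGen (Q.incl u) w →
        R.incl v = V (Q.incl u) → ‖v‖ = ‖u‖ := by
      intro u v w h e
      have h1 : ‖v‖ ^ 2 = ‖u‖ ^ 2 := by
        rw [norm_sq_dom1_of_isGen u h, norm_sq_dom1_of_isGen v (w := V w) (e ▸ hV _ _ h), e,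
          ← map_sub, V.inner_map_map]
      exact (sq_eq_sq₀ (norm_nonneg _) (norm_nonneg _)).mp h1
    intro u
    -- Approximate `u` in form norm from the core. The images form a Cauchy sequence for the form
    -- norm of `R`, which converges because `R` is closed; continuity of the inclusions identifies
    -- the limit as `V u`.
    obtain ⟨x, hx, hxu⟩ := mem_closure_iff_seq_limit.mp (hQ.dense_isGen u)
    choose w hw using hx
    let y : ℕ → R.Dom1 := fun n => show R.domain from ⟨V (Q.incl (x n)), (hV _ _ (hw n)).1⟩
    have hy : ∀ n, R.incl (y n) = V (Q.incl (x n)) := fun n => rfl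
    have hyx : ∀ n m, dist (y n) (y m) = dist (x n) (x m) := by
      intro n m
      rw [dist_eq_norm, dist_eq_norm]
      refine hnorm _ _ (w n - w m) ?_ ?_
      · rw [map_sub]
        exact (hw n).sub (hw m)
      · rw [map_sub, map_sub, map_sub, hy, hy]
    have hc : CauchySeq y := by
      have := hxu.cauchySeq
      rw [Metric.cauchySeq_iff] at this ⊢
      simpa only [hyx] using this
    obtain ⟨v, hv⟩ := cauchySeq_tendsto_of_complete hc
    refine ⟨v, ?_, ?_⟩
    · have h1 := (R.inclL.continuous.tendsto v).comp hv
      have h2 := ((V.continuous.comp Q.inclL.continuous).tendsto u).comp hxu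
      exact tendsto_nhds_unique h1 h2
    · refine tendsto_nhds_unique hv.norm (hxu.norm.congr fun n => ?_)
      exact (hnorm _ _ _ (hw n) (hy n)).symm
  choose J hJ hn using key
  refine ⟨⟨⟨⟨J, fun u v => ?_⟩, fun c u => ?_⟩, hn⟩, hJ⟩
  · exact R.incl_injective (by simp [hJ])
  · exact R.incl_injective (by simp [hJ])

/-- A unitary operator which intertwines the semigroups of two closed forms restricts to an isometry
between the form domains. -/
theorem IsClosed.exists_dom1_isometry_of_semigroup [CompleteSpace H] {Q : QuadForm H}
    {R : QuadForm G} (hQ : Q.IsClosed) (hR : R.IsClosed) {T : ℝ≥0 → H →L[ℝ] H}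
    {S : ℝ≥0 → G →L[ℝ] G} (hT : Q.IsSemigroup T) (hS : R.IsSemigroup S) (V : H ≃ₗᵢ[ℝ] G)
    (h : ∀ t f, S t (V f) = V (T t f)) :
    ∃ J : Q.Dom1 →ₗᵢ[ℝ] R.Dom1, ∀ u, R.incl (J u) = V (Q.incl u) := by
  refine hQ.exists_dom1_isometry hR V fun u w hu => (hS.generator _ _).mp ?_
  refine ((V.continuous.tendsto w).comp ((hT.generator u w).mpr hu)).congr fun t => ?_
  simp [h]

theorem comap_form (Q : QuadForm H) (ι : G ≃ₗᵢ[ℝ] H) (f g : (Q.comap ι).domain) :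
    (Q.comap ι).form f g = Q.form ⟨ι f, f.2⟩ ⟨ι g, g.2⟩ := rfl

theorem Intertwines.comap {H' G' : Type*} [NormedAddCommGroup H'] [InnerProductSpace ℝ H']
    [NormedAddCommGroup G'] [InnerProductSpace ℝ G'] {Q : QuadForm H} {R : QuadForm G}
    {B : H →L[ℝ] G} (h : Q.Intertwines R B) (ι : H' ≃ₗᵢ[ℝ] H) (ι' : G' ≃ₗᵢ[ℝ] G) {V : H' →L[ℝ] G'}
    (hV : ∀ f, ι' (V f) = B (ι f)) : (Q.comap ι).Intertwines (R.comap ι') V := by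
  refine ⟨le_antisymm ?_ fun g hg => ?_, fun f g hf hg => ?_⟩
  · rintro _ ⟨f, hf, rfl⟩
    have h1 : B (ι f) ∈ R.domain := h.map_domain ▸ ⟨ι f, hf, rfl⟩
    rw [← hV] at h1
    exact h1
  · have h1 : ι' g ∈ R.domain := hg
    rw [← h.map_domain] at h1
    obtain ⟨x, hx, e⟩ := h1
    refine ⟨ι.symm x, ?_, ι'.injective ?_⟩
    · change ι (ι.symm x) ∈ Q.domain
      rw [ι.apply_symm_apply]
      exact hx
    · refine (hV _).trans ?_
      rw [ι.apply_symm_apply]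
      exact e
  · rw [comap_form, comap_form]
    simp only [hV]
    exact h.form_eq ⟨ι f, f.2⟩ ⟨ι g, g.2⟩ _ _

end QuadForm

/-! ### Direct integrals of bounded and unitary operators. -/

namespace VectorFieldSpace

variable {Z : Type*} [MeasurableSpace Z] {ν : Measure Z} {H H' : Z → Type*}
  [∀ ζ, NormedAddCommGroup (H ζ)] [∀ ζ, InnerProductSpace ℝ (H ζ)]
  [∀ ζ, NormedAddCommGroup (H' ζ)] [∀ ζ, InnerProductSpace ℝ (H' ζ)]
  {S : VectorFieldSpace ν H} {S' : VectorFieldSpace ν H'}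

/-- Axiom (b) sees a field only through inner products up to null sets. Fiberwise constructions may
therefore take any value on a null set. -/
theorem mem_of_ae_eq {u v : ∀ ζ, H ζ} (hu : u ∈ S.fields) (h : ∀ᵐ ζ ∂ν, u ζ = v ζ) :
    v ∈ S.fields := by
  refine S.mem_of_inner_meas v fun w hw => (S.aemeasurable_inner hw hu).congr ?_
  filter_upwards [h] with ζ hζ
  rw [hζ]

theorem mem_sqInt_of_norm_le {u : ∀ ζ, H ζ} {v : ∀ ζ, H' ζ} (hu : u ∈ S.sqInt)
    (hv : v ∈ S'.fields) (C : ℝ) (h : ∀ᵐ ζ ∂ν, ‖v ζ‖ ≤ C * ‖u ζ‖) : v ∈ S'.sqInt := by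
  refine ⟨hv, (hu.2.const_mul C).mono (S'.norm_meas _ hv).aestronglyMeasurable ?_⟩
  filter_upwards [h] with ζ hζ
  rw [norm_norm]
  exact hζ.trans (le_abs_self _)

theorem norm_sqInt_sq (u : S.SqInt) : ‖u‖ ^ 2 = ∫ ζ, ‖S.toField u ζ‖ ^ 2 ∂ν := by
  rw [← real_inner_self_eq_norm_sq, inner_sqInt]
  simp only [real_inner_self_eq_norm_sq]

theorem cls_eq_cls_iff {u v : ∀ ζ, H ζ} (hu : u ∈ S.sqInt) (hv : v ∈ S.sqInt) :
    S.cls u hu = S.cls v hv ↔ ∀ᵐ ζ ∂ν, u ζ = v ζ :=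
  S.mk_eq_mk_iff _ _

theorem norm_cls_sq {u : ∀ ζ, H ζ} (hu : u ∈ S.sqInt) :
    ‖S.cls u hu‖ ^ 2 = ∫ ζ, ‖u ζ‖ ^ 2 ∂ν := by
  rw [cls, SeparationQuotient.norm_mk, norm_sqInt_sq]
  rfl

theorem exists_cls_eq (x : S.DirectIntegral) :
    ∃ (u : ∀ ζ, H ζ) (hu : u ∈ S.sqInt), S.cls u hu = x := by
  obtain ⟨u, rfl⟩ := SeparationQuotient.surjective_mk x
  exact ⟨u.1, u.2, rfl⟩

/-- An essentially bounded measurable field of operators has a direct integral. -/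
theorem exists_isDirectIntegralOp (U : ∀ ζ, H ζ →L[ℝ] H' ζ)
    (hU : ∀ u ∈ S.fields, (fun ζ => U ζ (u ζ)) ∈ S'.fields)
    (hC : ∃ C : ℝ, ∀ᵐ ζ ∂ν, ‖U ζ‖ ≤ C) : ∃ B, IsDirectIntegralOp S S' U B := by
  obtain ⟨C, hC⟩ := hC
  have hle : ∀ u : ∀ ζ, H ζ, ∀ᵐ ζ ∂ν, ‖U ζ (u ζ)‖ ≤ |C| * ‖u ζ‖ := fun u => by
    filter_upwards [hC] with ζ hζ
    exact (U ζ).le_of_opNorm_le (hζ.trans (le_abs_self C)) _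
  have hmem : ∀ u ∈ S.sqInt, (fun ζ => U ζ (u ζ)) ∈ S'.sqInt := fun u hu =>
    mem_sqInt_of_norm_le hu (hU _ hu.1) |C| (hle u)
  let B₀ : S.SqInt →ₗ[ℝ] S'.SqInt :=
    { toFun := fun u => show S'.sqInt from ⟨fun ζ => U ζ (S.toField u ζ), hmem _ u.2⟩
      map_add' := fun u v => Subtype.ext (funext fun ζ => map_add (U ζ) _ _)
      map_smul' := fun c u => Subtype.ext (funext fun ζ => map_smul (U ζ) c _) }
  have hB₀ : ∀ u ζ, S'.toField (B₀ u) ζ = U ζ (S.toField u ζ) := fun _ _ => rfl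
  have hbound : ∀ u, ‖B₀ u‖ ≤ |C| * ‖u‖ := by
    intro u
    refine le_of_sq_le_sq ?_ (by positivity)
    rw [mul_pow, norm_sqInt_sq, norm_sqInt_sq, ← integral_const_mul]
    refine integral_mono_ae (S'.memLp_norm _).integrable_sq
      ((S.memLp_norm _).integrable_sq.const_mul _) ?_
    filter_upwards [hle (S.toField u)] with ζ hζ
    simp only [hB₀]
    rw [← mul_pow]
    exact pow_le_pow_left₀ (norm_nonneg _) hζ 2
  let B₁ : S.SqInt →L[ℝ] S'.SqInt := B₀.mkContinuous |C| hbound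
  refine ⟨SeparationQuotient.liftCLM ((SeparationQuotient.mkCLM ℝ S'.SqInt).comp B₁) ?_, hU,
    ⟨C, hC⟩, fun u hu => ⟨hmem u hu, rfl⟩⟩
  intro x y hxy
  exact SeparationQuotient.mk_eq_mk.mpr (hxy.map B₁.continuous)

/-- A measurable field of unitary operators has a unitary direct integral. -/
theorem exists_isDirectIntegralOp_equiv (U : ∀ ζ, H ζ →L[ℝ] H' ζ)
    (hU : ∀ u ∈ S.fields, (fun ζ => U ζ (u ζ)) ∈ S'.fields)
    (W : ∀ ζ, H' ζ →L[ℝ] H ζ)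
    (hV : ∀ᵐ ζ ∂ν, ∃ V : H ζ ≃ₗᵢ[ℝ] H' ζ, (∀ u, V u = U ζ u) ∧ ∀ u, V.symm u = W ζ u) :
    ∃ B : S.DirectIntegral ≃ₗᵢ[ℝ] S'.DirectIntegral,
      IsDirectIntegralOp S S' U (B.toContinuousLinearEquiv : _ →L[ℝ] _) ∧
      IsDirectIntegralOp S' S W (B.symm.toContinuousLinearEquiv : _ →L[ℝ] _) := by
  -- The inverse field is measurable because `⟪u, W v⟫ = ⟪U u, v⟫` almost everywhere, which is what
  -- axiom (b) tests.
  have hWm : ∀ v ∈ S'.fields, (fun ζ => W ζ (v ζ)) ∈ S.fields := by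
    intro v hv
    refine S.mem_of_inner_meas _ fun u hu => (S'.aemeasurable_inner (hU u hu) hv).congr ?_
    filter_upwards [hV] with ζ ⟨V, h1, h2⟩
    rw [← h1, ← h2, ← V.inner_map_map (u ζ), LinearIsometryEquiv.apply_symm_apply]
  obtain ⟨B, hB⟩ := exists_isDirectIntegralOp (S := S) (S' := S') U hU ⟨1, by
    filter_upwards [hV] with ζ ⟨V, h, _⟩
    exact (U ζ).opNorm_le_bound zero_le_one fun u => by rw [← h]; simp⟩
  obtain ⟨B', hB'⟩ := exists_isDirectIntegralOp (S := S') (S' := S) W hWm ⟨1, by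
    filter_upwards [hV] with ζ ⟨V, _, h⟩
    exact (W ζ).opNorm_le_bound zero_le_one fun u => by rw [← h]; simp⟩
  have h1 : ∀ x, B' (B x) = x := by
    intro x
    obtain ⟨u, hu, rfl⟩ := exists_cls_eq x
    obtain ⟨hv, e⟩ := hB.apply_cls u hu
    obtain ⟨hw, e'⟩ := hB'.apply_cls _ hv
    rw [e, e', cls_eq_cls_iff]
    filter_upwards [hV] with ζ ⟨V, h1, h2⟩
    rw [← h1, ← h2, LinearIsometryEquiv.symm_apply_apply]
  have h2 : ∀ x, B (B' x) = x := by
    intro x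
    obtain ⟨u, hu, rfl⟩ := exists_cls_eq x
    obtain ⟨hv, e⟩ := hB'.apply_cls u hu
    obtain ⟨hw, e'⟩ := hB.apply_cls _ hv
    rw [e, e', cls_eq_cls_iff]
    filter_upwards [hV] with ζ ⟨V, h1, h2⟩
    rw [← h1, ← h2, LinearIsometryEquiv.apply_symm_apply]
  have h3 : ∀ x, ‖B x‖ = ‖x‖ := by
    intro x
    obtain ⟨u, hu, rfl⟩ := exists_cls_eq x
    obtain ⟨hv, e⟩ := hB.apply_cls u hu
    rw [← sq_eq_sq₀ (norm_nonneg _) (norm_nonneg _), e, norm_cls_sq, norm_cls_sq]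
    refine integral_congr_ae ?_
    filter_upwards [hV] with ζ ⟨V, h1, _⟩
    rw [← h1, LinearIsometryEquiv.norm_map]
  exact ⟨LinearIsometryEquiv.mk (LinearEquiv.ofLinearMap
    (B : S.DirectIntegral →ₗ[ℝ] S'.DirectIntegral)
    (B' : S'.DirectIntegral →ₗ[ℝ] S.DirectIntegral) (LinearMap.ext h2) (LinearMap.ext h1)) h3,
    hB, hB'⟩

end VectorFieldSpace

/-! ### Direct integrals of forms. -/

namespace FormField

variable {Z : Type*} [MeasurableSpace Z] {ν : Measure Z} {H H' : Z → Type*}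
  [∀ ζ, NormedAddCommGroup (H ζ)] [∀ ζ, InnerProductSpace ℝ (H ζ)]
  [∀ ζ, NormedAddCommGroup (H' ζ)] [∀ ζ, InnerProductSpace ℝ (H' ζ)]

variable {F : FormField ν H} {F' : FormField ν H'} {U : ∀ ζ, H ζ →L[ℝ] H' ζ}

/-- A direct integral of operators which restrict to isometries of the form domains lifts to the
square-integrable fields in the form domains. -/
theorem exists_inclDI_eq
    (hF' : ∀ u : ∀ ζ, (F'.form ζ).Dom1,
      (fun ζ => (F'.form ζ).incl (u ζ)) ∈ F'.SH.fields → u ∈ F'.SQ.fields)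
    {B : F.SH.DirectIntegral →L[ℝ] F'.SH.DirectIntegral}
    (hB : VectorFieldSpace.IsDirectIntegralOp F.SH F'.SH U B)
    (hJ : ∀ᵐ ζ ∂ν, ∃ J : (F.form ζ).Dom1 →ₗᵢ[ℝ] (F'.form ζ).Dom1,
      ∀ u, (F'.form ζ).incl (J u) = U ζ ((F.form ζ).incl u)) (u : F.SQ.SqInt) :
    ∃ v : F'.SQ.SqInt, F'.inclDI v = B (F.inclDI u) := by
  classical
  obtain ⟨h, e⟩ := hB.apply_cls _ (F.incl_mem_sqInt u)
  -- `J` is chosen in each fiber without any measurability, and `0` is put where there is none.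
  -- Still `v` lies in `S_Q`: its inclusion agrees almost everywhere with the measurable field `U
  -- u`, and `hF'` asks for no more.
  let v : ∀ ζ, (F'.form ζ).Dom1 := fun ζ =>
    if h : ∃ J : (F.form ζ).Dom1 →ₗᵢ[ℝ] (F'.form ζ).Dom1,
      ∀ u, (F'.form ζ).incl (J u) = U ζ ((F.form ζ).incl u) then h.choose (F.SQ.toField u ζ) else 0
  have hv : ∀ᵐ ζ ∂ν, (F'.form ζ).incl (v ζ) = U ζ ((F.form ζ).incl (F.SQ.toField u ζ)) ∧
      ‖v ζ‖ = ‖F.SQ.toField u ζ‖ := by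
    filter_upwards [hJ] with ζ hζ
    simp only [v, dif_pos hζ]
    exact ⟨hζ.choose_spec _, hζ.choose.norm_map _⟩
  have h1 : v ∈ F'.SQ.fields := by
    refine hF' _ (VectorFieldSpace.mem_of_ae_eq h.1 ?_)
    filter_upwards [hv] with ζ hζ
    exact hζ.1.symm
  have h2 : v ∈ F'.SQ.sqInt := by
    refine VectorFieldSpace.mem_sqInt_of_norm_le u.2 h1 1 ?_
    filter_upwards [hv] with ζ hζ
    rw [hζ.2, one_mul]
    exact le_rfl
  refine ⟨show F'.SQ.sqInt from ⟨v, h2⟩, Eq.trans ?_ e.symm⟩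
  refine (VectorFieldSpace.cls_eq_cls_iff _ _).mpr ?_
  filter_upwards [hv] with ζ hζ
  exact hζ.1

/-- Fiberwise unitary equivalence of forms implies unitary equivalence of their direct integrals. -/
theorem directIntegral_intertwines
    (hF : ∀ u : ∀ ζ, (F.form ζ).Dom1,
      (fun ζ => (F.form ζ).incl (u ζ)) ∈ F.SH.fields → u ∈ F.SQ.fields)
    (hF' : ∀ u : ∀ ζ, (F'.form ζ).Dom1,
      (fun ζ => (F'.form ζ).incl (u ζ)) ∈ F'.SH.fields → u ∈ F'.SQ.fields)
    {W : ∀ ζ, H' ζ →L[ℝ] H ζ} {B : F.SH.DirectIntegral ≃ₗᵢ[ℝ] F'.SH.DirectIntegral}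
    (hB : VectorFieldSpace.IsDirectIntegralOp F.SH F'.SH U (B.toContinuousLinearEquiv : _ →L[ℝ] _))
    (hB' : VectorFieldSpace.IsDirectIntegralOp F'.SH F.SH W
      (B.symm.toContinuousLinearEquiv : _ →L[ℝ] _))
    (hiso : ∀ᵐ ζ ∂ν, ∀ u, ‖U ζ u‖ = ‖u‖)
    (hJ : ∀ᵐ ζ ∂ν, ∃ J : (F.form ζ).Dom1 →ₗᵢ[ℝ] (F'.form ζ).Dom1,
      ∀ u, (F'.form ζ).incl (J u) = U ζ ((F.form ζ).incl u))
    (hJ' : ∀ᵐ ζ ∂ν, ∃ J : (F'.form ζ).Dom1 →ₗᵢ[ℝ] (F.form ζ).Dom1,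
      ∀ u, (F.form ζ).incl (J u) = W ζ ((F'.form ζ).incl u)) :
    F.directIntegral.Intertwines F'.directIntegral (B.toContinuousLinearEquiv : _ →L[ℝ] _) := by
  refine ⟨le_antisymm ?_ ?_, ?_⟩
  · rintro _ ⟨_, ⟨u, rfl⟩, rfl⟩
    exact exists_inclDI_eq hF' hB hJ u
  · rintro _ ⟨v, rfl⟩
    obtain ⟨u, hu⟩ := exists_inclDI_eq hF hB' hJ' v
    exact ⟨F.inclDI u, ⟨u, rfl⟩, (congrArg B hu).trans (B.apply_symm_apply _)⟩
  · rintro ⟨_, u₁, rfl⟩ ⟨_, u₂, rfl⟩ h₁ h₂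
    obtain ⟨v₁, e₁⟩ := exists_inclDI_eq hF' hB hJ u₁
    obtain ⟨v₂, e₂⟩ := exists_inclDI_eq hF' hB hJ u₂
    have hae : ∀ (u : F.SQ.SqInt) (v : F'.SQ.SqInt),
        F'.inclDI v = (B.toContinuousLinearEquiv : _ →L[ℝ] _) (F.inclDI u) →
        ∀ᵐ ζ ∂ν, (F'.form ζ).incl (F'.SQ.toField v ζ) =
          U ζ ((F.form ζ).incl (F.SQ.toField u ζ)) := by
      intro u v e
      obtain ⟨h, e'⟩ := hB.apply_cls _ (F.incl_mem_sqInt u)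
      exact (VectorFieldSpace.cls_eq_cls_iff (F'.incl_mem_sqInt v) h).mp (e.trans e')
    simp only [← e₁, ← e₂]
    rw [directIntegral_form_apply, directIntegral_form_apply]
    refine integral_congr_ae ?_
    filter_upwards [hae u₁ v₁ e₁, hae u₂ v₂ e₂, hiso, hJ] with ζ a₁ a₂ hi ⟨J, hJ⟩
    have b₁ := (F'.form ζ).incl_injective (a₁.trans (hJ _).symm)
    have b₂ := (F'.form ζ).incl_injective (a₂.trans (hJ _).symm)
    have h := J.inner_map_map (F.SQ.toField u₁ ζ) (F.SQ.toField u₂ ζ)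
    have h' := LinearIsometry.inner_map_map ⟨(U ζ : H ζ →ₗ[ℝ] H' ζ), hi⟩
      ((F.form ζ).incl (F.SQ.toField u₁ ζ)) ((F.form ζ).incl (F.SQ.toField u₂ ζ))
    rw [QuadForm.inner_dom1, QuadForm.inner_dom1, hJ, hJ] at h
    rw [b₁, b₂]
    -- `J` preserves `Q₁` and `U ζ` preserves the ambient inner product, so the difference, the form
    -- itself, is preserved.
    exact add_right_cancel (h.trans (congrArg (_ + ·) h'.symm))

end FormField

/-! ### Pseudo-disintegrations and the diagonal embedding. -/

theorem eLpNorm_two_sq {X : Type*} [MeasurableSpace X] (μ : Measure X) (f : X → ℝ) :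
    eLpNorm f 2 μ ^ 2 = ∫⁻ x, ‖f x‖ₑ ^ 2 ∂μ := by
  have h := eLpNorm_nnreal_pow_eq_lintegral (μ := μ) (f := f) (p := 2) two_ne_zero
  simpa using h

namespace IsPseudoDisintegration

variable {X Z : Type*} [MeasurableSpace X] [MeasurableSpace Z] {μ : Measure X} {ν : Measure Z}
  {κ : Z → Measure X}

theorem lintegral_of_measurable (hκ : IsPseudoDisintegration μ ν κ) {f : X → ℝ≥0∞}
    (hf : Measurable f) :
    AEMeasurable (fun ζ => ∫⁻ x, f x ∂κ ζ) ν ∧ ∫⁻ x, f x ∂μ = ∫⁻ ζ, ∫⁻ x, f x ∂κ ζ ∂ν := by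
  refine Measurable.ennreal_induction (motive := fun f => AEMeasurable (fun ζ => ∫⁻ x, f x ∂κ ζ) ν ∧
    ∫⁻ x, f x ∂μ = ∫⁻ ζ, ∫⁻ x, f x ∂κ ζ ∂ν) (fun c s hs => ?_) (fun f g _ hf hg h1 h2 => ?_)
    (fun f hf hmono h => ?_) hf
  · simp only [lintegral_indicator_const hs]
    exact ⟨(hκ.meas s hs).const_mul c, by
      rw [lintegral_const_mul'' _ (hκ.meas s hs), hκ.eq_lintegral s hs]⟩
  · simp only [Pi.add_apply, lintegral_add_left hf]
    exact ⟨h1.1.add h2.1, by rw [lintegral_add_left' h1.1, h1.2, h2.2]⟩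
  · simp only [lintegral_iSup hf hmono]
    refine ⟨AEMeasurable.iSup fun n => (h n).1, ?_⟩
    rw [lintegral_iSup' (fun n => (h n).1) (ae_of_all _ fun ζ n m hnm =>
      lintegral_mono (hmono hnm))]
    simp only [(h _).2]

theorem ae_ae_of_ae (hκ : IsPseudoDisintegration μ ν κ) {p : X → Prop} (h : ∀ᵐ x ∂μ, p x) :
    ∀ᵐ ζ ∂ν, ∀ᵐ x ∂κ ζ, p x := by
  have h0 := measure_toMeasurable (μ := μ) {x | ¬ p x}
  rw [ae_iff.mp h, hκ.eq_lintegral _ (measurableSet_toMeasurable _ _),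
    lintegral_eq_zero_iff' (hκ.meas _ (measurableSet_toMeasurable _ _))] at h0
  filter_upwards [h0] with ζ hζ
  exact measure_mono_null (subset_toMeasurable μ _) hζ

/-- The exceptional set is enlarged to a measurable set by a `μ`-null set, which is also null for
almost every `κ ζ`; the disintegration formula then applies to the measurable set. -/
theorem ae_of_ae_ae (hκ : IsPseudoDisintegration μ ν κ) {p : X → Prop}
    (hp : NullMeasurableSet {x | p x} μ) (h : ∀ᵐ ζ ∂ν, ∀ᵐ x ∂κ ζ, p x) : ∀ᵐ x ∂μ, p x := by
  obtain ⟨t, hst, ht, hts⟩ := hp.compl.exists_measurable_superset_ae_eq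
  have h1 := hκ.ae_ae_of_ae hts.mem_iff
  have h0 : μ t = 0 := by
    rw [hκ.eq_lintegral t ht, lintegral_eq_zero_iff' (hκ.meas t ht)]
    filter_upwards [h, h1] with ζ h2 h3
    refine measure_eq_zero_iff_ae_notMem.mpr ?_
    filter_upwards [h2, h3] with x h4 h5 h6
    exact h5.mp h6 h4
  exact measure_mono_null hst h0

theorem lintegral_of_aemeasurable (hκ : IsPseudoDisintegration μ ν κ) {f : X → ℝ≥0∞}
    (hf : AEMeasurable f μ) :
    AEMeasurable (fun ζ => ∫⁻ x, f x ∂κ ζ) ν ∧ ∫⁻ x, f x ∂μ = ∫⁻ ζ, ∫⁻ x, f x ∂κ ζ ∂ν := by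
  have h1 := hκ.lintegral_of_measurable hf.measurable_mk
  have h2 : ∀ᵐ ζ ∂ν, ∫⁻ x, f x ∂κ ζ = ∫⁻ x, hf.mk f x ∂κ ζ := by
    filter_upwards [hκ.ae_ae_of_ae hf.ae_eq_mk] with ζ hζ
    exact lintegral_congr_ae hζ
  exact ⟨h1.1.congr (h2.mono fun _ h => h.symm),
    (lintegral_congr_ae hf.ae_eq_mk).trans (h1.2.trans (lintegral_congr_ae h2).symm)⟩

theorem ae_memLp (hκ : IsPseudoDisintegration μ ν κ) {f : X → ℝ} (hf : MemLp f 2 μ) :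
    ∀ᵐ ζ ∂ν, MemLp f 2 (κ ζ) := by
  obtain ⟨h1, h2⟩ := hκ.lintegral_of_aemeasurable (hf.1.enorm.pow_const 2)
  have h3 : ∫⁻ ζ, ∫⁻ x, ‖f x‖ₑ ^ 2 ∂κ ζ ∂ν ≠ ∞ := by
    rw [← h2, ← eLpNorm_two_sq]
    exact ENNReal.pow_ne_top hf.2.ne
  filter_upwards [ae_lt_top' h1 h3, hκ.ae_ae_of_ae hf.1.ae_eq_mk] with ζ h4 h5
  refine ⟨⟨_, hf.1.stronglyMeasurable_mk, h5⟩, ?_⟩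
  rw [← eLpNorm_two_sq] at h4
  exact lt_top_iff_ne_top.mpr fun h => by simp [h] at h4

end IsPseudoDisintegration

theorem diagEmb_of_memLp {X Z : Type*} [MeasurableSpace X] {κ : Z → Measure X} {f : X → ℝ} {ζ : Z}
    (h : MemLp f 2 (κ ζ)) : diagEmb κ f ζ = h.toLp f := dif_pos h

namespace IsPseudoDisintegration

variable {X Z : Type*} [MeasurableSpace X] [MeasurableSpace Z] {μ : Measure X} {ν : Measure Z}
  {κ : Z → Measure X}

theorem diagEmb_ae_eq (hκ : IsPseudoDisintegration μ ν κ) {f : X → ℝ} (hf : MemLp f 2 μ) :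
    ∀ᵐ ζ ∂ν, diagEmb κ f ζ =ᵐ[κ ζ] f := by
  filter_upwards [hκ.ae_memLp hf] with ζ hζ
  rw [diagEmb_of_memLp hζ]
  exact hζ.coeFn_toLp

theorem diagEmb_add (hκ : IsPseudoDisintegration μ ν κ) {f g : X → ℝ} (hf : MemLp f 2 μ)
    (hg : MemLp g 2 μ) : ∀ᵐ ζ ∂ν, diagEmb κ (f + g) ζ = diagEmb κ f ζ + diagEmb κ g ζ := by
  filter_upwards [hκ.ae_memLp hf, hκ.ae_memLp hg] with ζ h1 h2
  rw [diagEmb_of_memLp h1, diagEmb_of_memLp h2, diagEmb_of_memLp (h1.add h2), MemLp.toLp_add]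

theorem diagEmb_sub (hκ : IsPseudoDisintegration μ ν κ) {f g : X → ℝ} (hf : MemLp f 2 μ)
    (hg : MemLp g 2 μ) : ∀ᵐ ζ ∂ν, diagEmb κ (f - g) ζ = diagEmb κ f ζ - diagEmb κ g ζ := by
  filter_upwards [hκ.ae_memLp hf, hκ.ae_memLp hg] with ζ h1 h2
  rw [diagEmb_of_memLp h1, diagEmb_of_memLp h2, diagEmb_of_memLp (h1.sub h2), MemLp.toLp_sub]

theorem diagEmb_smul (hκ : IsPseudoDisintegration μ ν κ) (c : ℝ) {f : X → ℝ} (hf : MemLp f 2 μ) :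
    ∀ᵐ ζ ∂ν, diagEmb κ (c • f) ζ = c • diagEmb κ f ζ := by
  filter_upwards [hκ.ae_memLp hf] with ζ h1
  rw [diagEmb_of_memLp h1, diagEmb_of_memLp (h1.const_smul c), MemLp.toLp_const_smul]

theorem diagEmb_congr (hκ : IsPseudoDisintegration μ ν κ) {f g : X → ℝ} (hf : MemLp f 2 μ)
    (h : f =ᵐ[μ] g) : ∀ᵐ ζ ∂ν, diagEmb κ f ζ = diagEmb κ g ζ := by
  filter_upwards [hκ.ae_memLp hf, hκ.ae_ae_of_ae h] with ζ h1 h2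
  rw [diagEmb_of_memLp h1, diagEmb_of_memLp (h1.ae_eq h2)]
  exact (MemLp.toLp_eq_toLp_iff h1 _).mpr h2

theorem enorm_diagEmb_sq (hκ : IsPseudoDisintegration μ ν κ) {f : X → ℝ} (hf : MemLp f 2 μ) :
    ∀ᵐ ζ ∂ν, ‖diagEmb κ f ζ‖ₑ ^ 2 = ∫⁻ x, ‖f x‖ₑ ^ 2 ∂κ ζ := by
  filter_upwards [hκ.ae_memLp hf] with ζ h1
  rw [diagEmb_of_memLp h1, Lp.enorm_toLp, eLpNorm_two_sq]

theorem aemeasurable_enorm_diagEmb_sq (hκ : IsPseudoDisintegration μ ν κ) {f : X → ℝ}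
    (hf : MemLp f 2 μ) : AEMeasurable (fun ζ => ‖diagEmb κ f ζ‖ₑ ^ 2) ν :=
  (hκ.lintegral_of_aemeasurable (hf.1.enorm.pow_const 2)).1.congr
    ((hκ.enorm_diagEmb_sq hf).mono fun _ h => h.symm)

theorem lintegral_enorm_diagEmb_sq (hκ : IsPseudoDisintegration μ ν κ) {f : X → ℝ}
    (hf : MemLp f 2 μ) : ∫⁻ ζ, ‖diagEmb κ f ζ‖ₑ ^ 2 ∂ν = eLpNorm f 2 μ ^ 2 := by
  rw [eLpNorm_two_sq, (hκ.lintegral_of_aemeasurable (hf.1.enorm.pow_const 2)).2]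
  exact lintegral_congr_ae (hκ.enorm_diagEmb_sq hf)

/-- `δ` maps `L²(μ)` into every space of measurable vector fields which contains the image of a
dense set. -/
theorem diagEmb_mem_fields (hκ : IsPseudoDisintegration μ ν κ)
    (S : VectorFieldSpace ν fun ζ => Lp ℝ 2 (κ ζ)) {𝒜 : Set (X → ℝ)}
    (hA : ∀ f ∈ 𝒜, MemLp f 2 μ) (hd : Dense {g : Lp ℝ 2 μ | ∃ f ∈ 𝒜, g =ᵐ[μ] f})
    (hS : ∀ f ∈ 𝒜, diagEmb κ f ∈ S.fields) {f : X → ℝ} (hf : MemLp f 2 μ) :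
    diagEmb κ f ∈ S.fields := by
  -- The rate `2⁻ⁿ` makes the integrals of the squared fiber norms summable, so that `δ(g n)`
  -- converges to `δ(f)` in almost every fiber without passing to a subsequence.
  have h1 : ∀ n : ℕ, ∃ g ∈ 𝒜, eLpNorm (f - g) 2 μ ≤ (2⁻¹ : ℝ≥0∞) ^ n := by
    intro n
    obtain ⟨g', ⟨g, hg, hgg'⟩, hdist⟩ := EMetric.mem_closure_iff.mp (hd (hf.toLp f))
      ((2⁻¹ : ℝ≥0∞) ^ n) (ENNReal.pow_pos (by simp) n)
    refine ⟨g, hg, ?_⟩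
    rw [Lp.edist_def, eLpNorm_congr_ae (hf.coeFn_toLp.sub hgg')] at hdist
    exact hdist.le
  choose g hg hfg using h1
  have hg' : ∀ n, MemLp (f - g n) 2 μ := fun n => hf.sub (hA _ (hg n))
  have h2 : ∫⁻ ζ, ∑' n, ‖diagEmb κ (f - g n) ζ‖ₑ ^ 2 ∂ν ≠ ∞ := by
    rw [lintegral_tsum fun n => hκ.aemeasurable_enorm_diagEmb_sq (hg' n)]
    simp only [hκ.lintegral_enorm_diagEmb_sq (hg' _)]
    refine ne_top_of_le_ne_top (b := ∑' n : ℕ, (2⁻¹ : ℝ≥0∞) ^ n) ?_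
      (ENNReal.tsum_le_tsum fun n => ?_)
    · rw [ENNReal.tsum_geometric, ENNReal.one_sub_inv_two, inv_inv]
      exact ENNReal.ofNat_ne_top
    · have h3 : (2⁻¹ : ℝ≥0∞) ^ n ≤ 1 := pow_le_one₀ (by simp) (by simp)
      calc eLpNorm (f - g n) 2 μ ^ 2 ≤ ((2⁻¹ : ℝ≥0∞) ^ n) ^ 2 := by gcongr; exact hfg n
        _ = (2⁻¹ : ℝ≥0∞) ^ n * (2⁻¹ : ℝ≥0∞) ^ n := sq _
        _ ≤ (2⁻¹ : ℝ≥0∞) ^ n * 1 := by gcongr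
        _ = _ := mul_one _
  have h3 : ∀ᵐ ζ ∂ν, Tendsto (fun n => diagEmb κ (g n) ζ) atTop (𝓝 (diagEmb κ f ζ)) := by
    have h4 := ae_all_iff.mpr fun n => hκ.diagEmb_sub hf (hA _ (hg n))
    filter_upwards [h4, ae_lt_top' (AEMeasurable.tsum fun n =>
      hκ.aemeasurable_enorm_diagEmb_sq (hg' n)) h2] with ζ h5 h6
    have h7 := ENNReal.tendsto_atTop_zero_of_tsum_ne_top h6.ne
    rw [tendsto_iff_edist_tendsto_0]
    have h8 := (ENNReal.continuous_rpow_const (y := (2 : ℝ)⁻¹)).tendsto 0 |>.comp h7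
    rw [ENNReal.zero_rpow_of_pos (by norm_num)] at h8
    refine h8.congr fun n => ?_
    rw [edist_comm, edist_eq_enorm_sub, ← h5, Function.comp_apply, ← ENNReal.rpow_natCast,
      ← ENNReal.rpow_mul]
    norm_num
  refine S.mem_of_inner_meas _ fun u hu => ?_
  refine aemeasurable_of_tendsto_metrizable_ae' (fun n => S.aemeasurable_inner hu (hS _ (hg n))) ?_
  filter_upwards [h3] with ζ hζ
  exact tendsto_const_nhds.inner hζ

theorem diagEmb_mem_sqInt (hκ : IsPseudoDisintegration μ ν κ)
    {S : VectorFieldSpace ν fun ζ => Lp ℝ 2 (κ ζ)} {f : X → ℝ} (hf : MemLp f 2 μ)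
    (h : diagEmb κ f ∈ S.fields) : diagEmb κ f ∈ S.sqInt := by
  refine ⟨h, (S.norm_meas _ h).aestronglyMeasurable, ?_⟩
  have h1 := hκ.lintegral_enorm_diagEmb_sq hf
  have h2 := eLpNorm_two_sq ν fun ζ => ‖diagEmb κ f ζ‖
  simp only [enorm_norm] at h2
  rw [← h2] at h1
  exact lt_top_iff_ne_top.mpr fun h => by
    rw [h] at h1
    exact ENNReal.pow_ne_top hf.2.ne (h1.symm.trans (by simp))

theorem norm_cls_diagEmb (hκ : IsPseudoDisintegration μ ν κ)
    {S : VectorFieldSpace ν fun ζ => Lp ℝ 2 (κ ζ)} {f : X → ℝ} (hf : MemLp f 2 μ)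
    (h : diagEmb κ f ∈ S.sqInt) : ‖S.cls _ h‖ = ‖hf.toLp f‖ := by
  rw [← sq_eq_sq₀ (norm_nonneg _) (norm_nonneg _), VectorFieldSpace.norm_cls_sq,
    integral_eq_lintegral_of_nonneg_ae (ae_of_all _ fun ζ => sq_nonneg _)
      ((S.norm_meas _ h.1).pow_const 2).aestronglyMeasurable, Lp.norm_toLp, ← ENNReal.toReal_pow,
    ← hκ.lintegral_enorm_diagEmb_sq hf]
  congr 1
  refine lintegral_congr fun ζ => ?_
  rw [ENNReal.ofReal_pow (norm_nonneg _), ofReal_norm]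

/-- The canonical isometry `[f] ↦ [δ(f)]`. -/
theorem exists_isometry (hκ : IsPseudoDisintegration μ ν κ)
    (S : VectorFieldSpace ν fun ζ => Lp ℝ 2 (κ ζ))
    (hS : ∀ f, MemLp f 2 μ → diagEmb κ f ∈ S.fields) :
    ∃ ι : Lp ℝ 2 μ →ₗᵢ[ℝ] S.DirectIntegral, ∀ (f : X → ℝ) (hf : MemLp f 2 μ),
      ∃ h : diagEmb κ f ∈ S.sqInt, ι (hf.toLp f) = S.cls _ h := by
  have hS' : ∀ f, MemLp f 2 μ → diagEmb κ f ∈ S.sqInt := fun f hf =>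
    hκ.diagEmb_mem_sqInt hf (hS f hf)
  refine ⟨⟨⟨⟨fun f => S.cls _ (hS' f (Lp.memLp f)), fun f g => ?_⟩, fun c f => ?_⟩, fun f => ?_⟩,
    fun f hf => ⟨hS' f hf, ?_⟩⟩
  · refine Eq.trans ((VectorFieldSpace.cls_eq_cls_iff _
      (S.sqInt.add_mem (hS' f (Lp.memLp f)) (hS' g (Lp.memLp g)))).mpr ?_) rfl
    filter_upwards [hκ.diagEmb_congr (Lp.memLp (f + g)) (Lp.coeFn_add f g),
      hκ.diagEmb_add (Lp.memLp f) (Lp.memLp g)] with ζ h1 h2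
    rw [h1, h2, Pi.add_apply]
  · refine Eq.trans ((VectorFieldSpace.cls_eq_cls_iff _
      (S.sqInt.smul_mem c (hS' f (Lp.memLp f)))).mpr ?_) rfl
    filter_upwards [hκ.diagEmb_congr (Lp.memLp (c • f)) (Lp.coeFn_smul c f),
      hκ.diagEmb_smul c (Lp.memLp f)] with ζ h1 h2
    rw [h1, h2, Pi.smul_apply]
  · refine (hκ.norm_cls_diagEmb (Lp.memLp f) _).trans ?_
    rw [Lp.toLp_coeFn]
  · refine (VectorFieldSpace.cls_eq_cls_iff _ _).mpr ?_
    exact hκ.diagEmb_congr (Lp.memLp _) hf.coeFn_toLp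

end IsPseudoDisintegration

/-! ### Surjectivity of the canonical map. -/

/-- The indicators of countably many sets are total in `L²(m)` for all measures `m` which are finite
on a given exhaustion. -/
theorem exists_countable_determining (X : Type*) [MeasurableSpace X]
    [MeasurableSpace.CountablyGenerated X] (K : ℕ → Set X) (hK : ∀ n, MeasurableSet (K n))
    (hU : ⋃ n, K n = Set.univ) :
    ∃ 𝒞 : Set (Set X), 𝒞.Countable ∧ (∀ A ∈ 𝒞, MeasurableSet A) ∧ (∀ A ∈ 𝒞, ∃ n, A ⊆ K n) ∧
      ∀ (m : Measure X), (∀ n, m (K n) < ∞) → ∀ f : Lp ℝ 2 m,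
        (∀ A ∈ 𝒞, ∫ x in A, f x ∂m = 0) → f = 0 := by
  set 𝒢 := generateSetAlgebra (MeasurableSpace.countableGeneratingSet X)
  have hgen : ‹MeasurableSpace X› = MeasurableSpace.generateFrom 𝒢 := by
    rw [generateFrom_generateSetAlgebra_eq, MeasurableSpace.generateFrom_countableGeneratingSet]
  have halg : IsSetAlgebra 𝒢 := isSetAlgebra_generateSetAlgebra
  have hmeas : ∀ A ∈ 𝒢, MeasurableSet A := fun A hA => by
    rw [hgen]
    exact MeasurableSpace.measurableSet_generateFrom hA
  refine ⟨Set.image2 (fun A n => A ∩ K n) 𝒢 Set.univ,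
    (countable_generateSetAlgebra MeasurableSpace.countable_countableGeneratingSet).image2
      Set.countable_univ _, ?_, ?_, ?_⟩
  · rintro _ ⟨A, hA, n, -, rfl⟩
    exact (hmeas A hA).inter (hK n)
  · rintro _ ⟨A, hA, n, -, rfl⟩
    exact ⟨n, Set.inter_subset_right⟩
  · intro m hm f hf
    have hn : ∀ n, f =ᵐ[m.restrict (K n)] 0 := by
      intro n
      have hint : Integrable f (m.restrict (K n)) :=
        integrableOn_Lp_of_measure_ne_top f fact_one_le_two_ennreal.elim (hm n).ne
      -- Dynkin's π-λ argument: the countable generating algebra is closed under intersections and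
      -- contains the whole space, which gives `∫ f = 0` over `K n` for the complement step.
      have hA : ∀ A, MeasurableSet A → ∫ x in A, f x ∂m.restrict (K n) = 0 := by
        intro A hA
        induction A, hA using MeasurableSpace.induction_on_inter hgen
          (fun A hA B hB _ => halg.inter_mem hA hB) with
        | empty => simp
        | basic A hA =>
          rw [Measure.restrict_restrict (hmeas A hA)]
          exact hf _ ⟨A, hA, n, trivial, rfl⟩
        | compl A hA ih =>
          have h1 := integral_add_compl hA hint
          have h2 := hf _ ⟨Set.univ, halg.univ_mem, n, trivial, rfl⟩
          simp only [Set.univ_inter] at h2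
          rw [ih, zero_add, h2] at h1
          exact h1
        | iUnion A hd hA ih =>
          rw [integral_iUnion hA hd hint.integrableOn]
          simp [ih]
      exact hint.ae_eq_zero_of_forall_setIntegral_eq_zero fun A h _ => hA A h
    refine (Lp.eq_zero_iff_ae_eq_zero).mpr ?_
    have h1 := (ae_restrict_iUnion_iff K fun x => f x = 0).mpr hn
    rw [hU, Measure.restrict_univ] at h1
    exact h1

namespace IsPseudoDisintegration

variable {X Z : Type*} [MeasurableSpace X] [MeasurableSpace Z] {μ : Measure X} {ν : Measure Z}
  {κ : Z → Measure X}

-- Here separation enters: `κ ζ` is carried by `s⁻¹ {ζ}`, so the indicator of `s⁻¹ B` is `κ ζ`-a.e.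
-- constant, with value `1` or `0` according to whether `ζ ∈ B`.
open Classical in
theorem exists_memLp_diagEmb_localize (hκ : IsPseudoDisintegration μ ν κ) {s : X → Z}
    (hs : NullMeasurable s μ) (hsep : ∀ᵐ ζ ∂ν, κ ζ (s ⁻¹' {ζ})ᶜ = 0) {f : X → ℝ}
    (hf : MemLp f 2 μ) {B : Set Z} (hB : MeasurableSet B) :
    ∃ g : X → ℝ, MemLp g 2 μ ∧
      ∀ᵐ ζ ∂ν, diagEmb κ g ζ = if ζ ∈ B then diagEmb κ f ζ else 0 := by
  -- `s⁻¹ B` is only `μ`-measurable; it is replaced by a measurable set that agrees with it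
  -- `μ`-a.e., hence `κ ζ`-a.e. for almost every `ζ`.
  obtain ⟨t, -, ht, hts⟩ := (hs hB).exists_measurable_superset_ae_eq
  have hg : MemLp (t.indicator f) 2 μ := hf.indicator ht
  refine ⟨_, hg, ?_⟩
  filter_upwards [hκ.ae_memLp hg, hκ.ae_memLp hf, hsep, hκ.ae_ae_of_ae hts.mem_iff]
    with ζ h1 h2 h3 h4
  have h5 : ∀ᵐ x ∂κ ζ, s x = ζ := by
    rw [ae_iff]
    exact h3
  rw [diagEmb_of_memLp h1]
  split_ifs with hζ
  · rw [diagEmb_of_memLp h2, MemLp.toLp_eq_toLp_iff]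
    filter_upwards [h4, h5] with x h6 h7
    rw [Set.indicator_of_mem (h6.mpr (by simpa [h7] using hζ))]
  · rw [Lp.eq_zero_iff_ae_eq_zero]
    filter_upwards [h1.coeFn_toLp, h4, h5] with x h8 h6 h7
    rw [h8]
    exact Set.indicator_of_notMem (fun h => hζ (by simpa [h7] using h6.mp h)) f

/-- Orthogonality to the localization of `f` to `B` says that the integral of the fiber inner
product over `B` vanishes; `B` is arbitrary. -/
theorem ae_inner_diagEmb_eq_zero (hκ : IsPseudoDisintegration μ ν κ) {s : X → Z}
    (hs : NullMeasurable s μ) (hsep : ∀ᵐ ζ ∂ν, κ ζ (s ⁻¹' {ζ})ᶜ = 0)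
    {S : VectorFieldSpace ν fun ζ => Lp ℝ 2 (κ ζ)}
    (hS : ∀ f, MemLp f 2 μ → diagEmb κ f ∈ S.sqInt) {u : ∀ ζ, Lp ℝ 2 (κ ζ)} (hu : u ∈ S.sqInt)
    (h : ∀ f, MemLp f 2 μ → ∫ ζ, inner ℝ (diagEmb κ f ζ) (u ζ) ∂ν = 0) {f : X → ℝ}
    (hf : MemLp f 2 μ) : ∀ᵐ ζ ∂ν, inner ℝ (diagEmb κ f ζ) (u ζ) = 0 := by
  classical
  have hint : Integrable (fun ζ => inner ℝ (diagEmb κ f ζ) (u ζ)) ν :=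
    S.integrable_inner (show S.sqInt from ⟨_, hS f hf⟩) (show S.sqInt from ⟨u, hu⟩)
  refine hint.ae_eq_zero_of_forall_setIntegral_eq_zero fun B hB _ => ?_
  obtain ⟨g, hg, hgf⟩ := hκ.exists_memLp_diagEmb_localize hs hsep hf hB
  rw [← h g hg, ← integral_indicator hB]
  refine integral_congr_ae ?_
  filter_upwards [hgf] with ζ hζ
  rw [hζ]
  by_cases hB : ζ ∈ B <;> simp [hB]

/-- The null set of fibers depends on the test function, so a countable family of indicators is used
that determines `L²(κ ζ)` for every `κ ζ` finite on the spanning sets of `μ`. -/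
theorem ae_eq_zero_of_orthogonal [MeasurableSpace.CountablyGenerated X] [SigmaFinite μ]
    (hκ : IsPseudoDisintegration μ ν κ) {s : X → Z}
    (hs : NullMeasurable s μ) (hsep : ∀ᵐ ζ ∂ν, κ ζ (s ⁻¹' {ζ})ᶜ = 0)
    {S : VectorFieldSpace ν fun ζ => Lp ℝ 2 (κ ζ)}
    (hS : ∀ f, MemLp f 2 μ → diagEmb κ f ∈ S.sqInt) {u : ∀ ζ, Lp ℝ 2 (κ ζ)} (hu : u ∈ S.sqInt)
    (h : ∀ f, MemLp f 2 μ → ∫ ζ, inner ℝ (diagEmb κ f ζ) (u ζ) ∂ν = 0) :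
    ∀ᵐ ζ ∂ν, u ζ = 0 := by
  obtain ⟨𝒞, hc, hm, hsub, hdet⟩ := exists_countable_determining X (spanningSets μ)
    (measurableSet_spanningSets μ) (iUnion_spanningSets μ)
  have hfin : ∀ᵐ ζ ∂ν, ∀ n, κ ζ (spanningSets μ n) < ∞ := by
    refine ae_all_iff.mpr fun n => ae_lt_top' (hκ.meas _ (measurableSet_spanningSets μ n)) ?_
    rw [← hκ.eq_lintegral _ (measurableSet_spanningSets μ n)]
    exact (measure_spanningSets_lt_top μ n).ne
  have hzero : ∀ᵐ ζ ∂ν, ∀ A ∈ 𝒞,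
      inner ℝ (diagEmb κ (A.indicator fun _ => (1 : ℝ)) ζ) (u ζ) = 0 := by
    refine (ae_ball_iff hc).mpr fun A hA => ?_
    obtain ⟨n, hn⟩ := hsub A hA
    refine hκ.ae_inner_diagEmb_eq_zero hs hsep hS hu h ?_
    exact memLp_indicator_const 2 (hm A hA) 1
      (Or.inr (measure_lt_top_of_subset hn (measure_spanningSets_lt_top μ n).ne).ne)
  filter_upwards [hfin, hzero] with ζ h1 h2
  refine hdet (κ ζ) h1 (u ζ) fun A hA => ?_
  obtain ⟨n, hn⟩ := hsub A hA
  have hA' : κ ζ A ≠ ∞ := (measure_lt_top_of_subset hn (h1 n).ne).ne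
  rw [← L2.inner_indicatorConstLp_one (hm A hA) hA', ← h2 A hA,
    diagEmb_of_memLp (memLp_indicator_const 2 (hm A hA) 1 (Or.inr hA'))]
  rfl

/-- For a separated pseudo-disintegration, the canonical map `[f] ↦ [δ(f)]` is unitary. -/
theorem exists_isCanonicalIso [MeasurableSpace.CountablyGenerated X] [SigmaFinite μ]
    (hκ : IsPseudoDisintegration μ ν κ) {s : X → Z}
    (hs : NullMeasurable s μ) (hsep : ∀ᵐ ζ ∂ν, κ ζ (s ⁻¹' {ζ})ᶜ = 0)
    (S : VectorFieldSpace ν fun ζ => Lp ℝ 2 (κ ζ))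
    (hS : ∀ f, MemLp f 2 μ → diagEmb κ f ∈ S.fields) :
    ∃ ι : Lp ℝ 2 μ ≃ₗᵢ[ℝ] S.DirectIntegral, IsCanonicalIso μ S ι := by
  obtain ⟨ι, hι⟩ := hκ.exists_isometry S hS
  have hS' : ∀ f, MemLp f 2 μ → diagEmb κ f ∈ S.sqInt := fun f hf => (hι f hf).1
  have hcomplete : CompleteSpace (LinearMap.range ι.toLinearMap) :=
    completeSpace_coe_iff_isComplete.mpr ι.isometry.isUniformInducing.isComplete_range
  have htop : LinearMap.range ι.toLinearMap = ⊤ := by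
    rw [← Submodule.orthogonal_eq_bot_iff, Submodule.eq_bot_iff]
    intro x hx
    obtain ⟨u, hu, rfl⟩ := VectorFieldSpace.exists_cls_eq x
    refine ((VectorFieldSpace.cls_eq_cls_iff hu S.sqInt.zero_mem).mpr ?_).trans rfl
    refine hκ.ae_eq_zero_of_orthogonal hs hsep hS' hu fun f hf => ?_
    have h1 := (Submodule.mem_orthogonal _ _).mp hx _ ⟨hf.toLp f, rfl⟩
    obtain ⟨h2, h3⟩ := hι f hf
    exact (congrArg (fun y => inner ℝ y (S.cls u hu)) h3).symm.trans h1
  exact ⟨LinearIsometryEquiv.ofSurjective ι (LinearMap.range_eq_top.mp htop), hι⟩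

end IsPseudoDisintegration

/-! ### Order and the main theorem. -/

namespace IsCanonicalIso

variable {X Z : Type*} [MeasurableSpace X] [MeasurableSpace Z] {μ : Measure X} {ν : Measure Z}
  {κ κ' : Z → Measure X}

/-- A direct integral of positive operators corresponds to a positive operator. -/
theorem nonneg_of_apply_eq (hκ : IsPseudoDisintegration μ ν κ) (hκ' : IsPseudoDisintegration μ ν κ')
    {S : VectorFieldSpace ν fun ζ => Lp ℝ 2 (κ ζ)} {S' : VectorFieldSpace ν fun ζ => Lp ℝ 2 (κ' ζ)}
    {ι : Lp ℝ 2 μ ≃ₗᵢ[ℝ] S.DirectIntegral} {ι' : Lp ℝ 2 μ ≃ₗᵢ[ℝ] S'.DirectIntegral}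
    (hι : IsCanonicalIso μ S ι) (hι' : IsCanonicalIso μ S' ι')
    {U : ∀ ζ, Lp ℝ 2 (κ ζ) →L[ℝ] Lp ℝ 2 (κ' ζ)} {B : S.DirectIntegral →L[ℝ] S'.DirectIntegral}
    (hB : VectorFieldSpace.IsDirectIntegralOp S S' U B)
    (hU : ∀ᵐ ζ ∂ν, ∀ f, 0 ≤ f → 0 ≤ U ζ f) {f g : Lp ℝ 2 μ} (hfg : ι' g = B (ι f)) (hf : 0 ≤ f) :
    0 ≤ g := by
  obtain ⟨h1, e1⟩ := hι f (Lp.memLp f)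
  obtain ⟨h2, e2⟩ := hι' g (Lp.memLp g)
  obtain ⟨h3, e3⟩ := hB.apply_cls _ h1
  rw [Lp.toLp_coeFn] at e1 e2
  rw [e1, e2, e3, VectorFieldSpace.cls_eq_cls_iff] at hfg
  refine (Lp.coeFn_nonneg g).mp ?_
  have hmeas : NullMeasurableSet {x | 0 ≤ g x} μ :=
    nullMeasurableSet_le aemeasurable_const (Lp.aestronglyMeasurable g).aemeasurable
  -- Positivity of `g` is tested in almost every fiber, where `g` represents `U ζ` applied to the
  -- class of `f`.
  refine hκ'.ae_of_ae_ae hmeas ?_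
  filter_upwards [hfg, hU, hκ.ae_ae_of_ae ((Lp.coeFn_nonneg f).mpr hf),
    hκ.diagEmb_ae_eq (Lp.memLp f), hκ'.diagEmb_ae_eq (Lp.memLp g)] with ζ a1 a2 a3 a4 a5
  have a6 : 0 ≤ diagEmb κ f ζ := by
    refine (Lp.coeFn_nonneg _).mp ?_
    filter_upwards [a3, a4] with x b1 b2
    rw [b2]
    exact b1
  have a7 := (Lp.coeFn_nonneg _).mpr (a2 _ a6)
  rw [← a1] at a7
  filter_upwards [a5, a7] with x b1 b2
  rw [← b1]
  exact b2

end IsCanonicalIso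

theorem mainTheorem5
    {X : Type*} [TopologicalSpace X] [PolishSpace X] [LocallyCompactSpace X]
    [MeasurableSpace X] [BorelSpace X] (μ : Measure X) [μ.Regular]
    {Z : Type*} [MeasurableSpace Z] [MeasurableSingletonClass Z]
    [MeasurableSpace.CountablyGenerated Z] (ν : Measure Z) [IsProbabilityMeasure ν]
    (s : X → Z) (hs : NullMeasurable s μ)
    (κ₁ κ₂ : Z → Measure X)
    (hκ₁ : IsPseudoDisintegration μ ν κ₁) (hκ₂ : IsPseudoDisintegration μ ν κ₂)
    (hs₁ : IsSeparatingFamily μ ν κ₁ fun ζ => s ⁻¹' {ζ})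
    (hs₂ : IsSeparatingFamily μ ν κ₂ fun ζ => s ⁻¹' {ζ})
    (E₁ : FormField ν fun ζ => Lp ℝ 2 (κ₁ ζ)) (E₂ : FormField ν fun ζ => Lp ℝ 2 (κ₂ ζ))
    (hE₁ : ∀ ζ, IsDirichletForm (E₁.form ζ)) (hE₂ : ∀ ζ, IsDirichletForm (E₂.form ζ))
    (hc₁ : IsCompatible μ E₁) (hc₂ : IsCompatible μ E₂)
    (T₁ : ∀ ζ, ℝ≥0 → Lp ℝ 2 (κ₁ ζ) →L[ℝ] Lp ℝ 2 (κ₁ ζ))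
    (T₂ : ∀ ζ, ℝ≥0 → Lp ℝ 2 (κ₂ ζ) →L[ℝ] Lp ℝ 2 (κ₂ ζ))
    (hT₁ : ∀ ζ, (E₁.form ζ).IsSemigroup (T₁ ζ)) (hT₂ : ∀ ζ, (E₂.form ζ).IsSemigroup (T₂ ζ))
    (U : ∀ ζ, Lp ℝ 2 (κ₁ ζ) →L[ℝ] Lp ℝ 2 (κ₂ ζ))
    (hUmeas : ∀ u ∈ E₁.SH.fields, (fun ζ => U ζ (u ζ)) ∈ E₂.SH.fields)
    (hU : ∀ᵐ ζ ∂ν, IsUnitaryOrderIso (U ζ))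
    (hUT : ∀ᵐ ζ ∂ν, ∀ t, (T₂ ζ t).comp (U ζ) = (U ζ).comp (T₁ ζ t)) :
    ∃ (ι₁ : Lp ℝ 2 μ ≃ₗᵢ[ℝ] E₁.SH.DirectIntegral) (ι₂ : Lp ℝ 2 μ ≃ₗᵢ[ℝ] E₂.SH.DirectIntegral)
      (B : E₁.SH.DirectIntegral →L[ℝ] E₂.SH.DirectIntegral) (V : Lp ℝ 2 μ →L[ℝ] Lp ℝ 2 μ),
      IsCanonicalIso μ E₁.SH ι₁ ∧ IsCanonicalIso μ E₂.SH ι₂ ∧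
      VectorFieldSpace.IsDirectIntegralOp E₁.SH E₂.SH U B ∧
      (∀ f, ι₂ (V f) = B (ι₁ f)) ∧
      IsUnitaryOrderIso V ∧
      QuadForm.Intertwines (E₁.directIntegral.comap ι₁) (E₂.directIntegral.comap ι₂) V ∧
      ∀ P₁ P₂ : ℝ≥0 → Lp ℝ 2 μ →L[ℝ] Lp ℝ 2 μ,
        (E₁.directIntegral.comap ι₁).IsSemigroup P₁ →
        (E₂.directIntegral.comap ι₂).IsSemigroup P₂ →
        ∀ t, (P₂ t).comp V = V.comp (P₁ t) := by

  classical
  -- A regular measure is finite on compact sets, hence locally finite on a locally compact space,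
  -- hence σ-finite by second countability.
  have : IsLocallyFiniteMeasure μ := isLocallyFiniteMeasure_of_isFiniteMeasureOnCompacts
  have hsigma : SigmaFinite μ := inferInstance
  obtain ⟨A₁, hA₁, hd₁, hAS₁, hSQ₁, -⟩ := hc₁
  obtain ⟨A₂, hA₂, hd₂, hAS₂, hSQ₂, -⟩ := hc₂
  obtain ⟨ι₁, hι₁⟩ := hκ₁.exists_isCanonicalIso hs hs₁.conegligible E₁.SH fun f hf =>
    hκ₁.diagEmb_mem_fields E₁.SH (𝒜 := A₁) hA₁ hd₁ hAS₁ hf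
  obtain ⟨ι₂, hι₂⟩ := hκ₂.exists_isCanonicalIso hs hs₂.conegligible E₂.SH fun f hf =>
    hκ₂.diagEmb_mem_fields E₂.SH (𝒜 := A₂) hA₂ hd₂ hAS₂ hf
  -- The field of inverses, set to `0` on the null set of fibers where `U ζ` is not a unitary order
  -- isomorphism.
  let W : ∀ ζ, Lp ℝ 2 (κ₂ ζ) →L[ℝ] Lp ℝ 2 (κ₁ ζ) := fun ζ =>
    if h : IsUnitaryOrderIso (U ζ) then (h.choose.symm.toContinuousLinearEquiv : _ →L[ℝ] _) else 0
  have hUW : ∀ᵐ ζ ∂ν, ∃ V : Lp ℝ 2 (κ₁ ζ) ≃ₗᵢ[ℝ] Lp ℝ 2 (κ₂ ζ),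
      ((∀ f, V f = U ζ f) ∧ ∀ g, V.symm g = W ζ g) ∧
      (∀ f, 0 ≤ f → 0 ≤ U ζ f) ∧ ∀ g, 0 ≤ g → 0 ≤ W ζ g := by
    filter_upwards [hU] with ζ h
    obtain ⟨h1, h2, h3⟩ := h.choose_spec
    have hW : ∀ g, h.choose.symm g = W ζ g := fun g => by simp [W, dif_pos h]
    exact ⟨h.choose, ⟨h1, hW⟩, fun f hf => h1 f ▸ h2 f hf, fun g hg => hW g ▸ h3 g hg⟩
  obtain ⟨B, hB, hB'⟩ := VectorFieldSpace.exists_isDirectIntegralOp_equiv U hUmeas W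
    (hUW.mono fun ζ ⟨V, h, _⟩ => ⟨V, h⟩)
  have hint : E₁.directIntegral.Intertwines E₂.directIntegral
      (B.toContinuousLinearEquiv : _ →L[ℝ] _) := by
    refine FormField.directIntegral_intertwines (fun u => (hSQ₁ u).mpr) (fun u => (hSQ₂ u).mpr)
      hB hB' ?_ ?_ ?_
    · filter_upwards [hUW] with ζ ⟨V, ⟨h, _⟩, _⟩ f
      rw [← h, V.norm_map]
    · filter_upwards [hUW, hUT] with ζ ⟨V, ⟨h, _⟩, _⟩ hT
      simp only [← h]
      refine (E₁.closed ζ).exists_dom1_isometry_of_semigroup (E₂.closed ζ) (hT₁ ζ) (hT₂ ζ) V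
        fun t f => ?_
      rw [h, h]
      exact DFunLike.congr_fun (hT t) f
    · filter_upwards [hUW, hUT] with ζ ⟨V, ⟨h, h'⟩, _⟩ hT
      simp only [← h']
      refine (E₂.closed ζ).exists_dom1_isometry_of_semigroup (E₁.closed ζ) (hT₂ ζ) (hT₁ ζ) V.symm
        fun t g => ?_
      rw [LinearIsometryEquiv.eq_symm_apply]
      have := DFunLike.congr_fun (hT t) (V.symm g)
      simp only [ContinuousLinearMap.comp_apply, ← h, V.apply_symm_apply] at this
      exact this.symm
  let V : Lp ℝ 2 μ ≃ₗᵢ[ℝ] Lp ℝ 2 μ := (ι₁.trans B).trans ι₂.symm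
  have hV : ∀ f, ι₂ (V f) = B (ι₁ f) := fun f => ι₂.apply_symm_apply _
  have hV' : ∀ g, ι₁ (V.symm g) = B.symm (ι₂ g) := fun g => by
    rw [LinearIsometryEquiv.eq_symm_apply, ← hV, V.apply_symm_apply]
  have hVint := hint.comap ι₁ ι₂ (V := (V.toContinuousLinearEquiv : _ →L[ℝ] _)) hV
  refine ⟨ι₁, ι₂, (B.toContinuousLinearEquiv : _ →L[ℝ] _),
    (V.toContinuousLinearEquiv : _ →L[ℝ] _), hι₁, hι₂, hB, hV, ⟨V, fun _ => rfl, fun f hf => ?_,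
      fun g hg => ?_⟩, hVint, fun P₁ P₂ hP₁ hP₂ t => hVint.semigroup (fun _ => rfl) hP₁ hP₂ t⟩
  · exact hι₁.nonneg_of_apply_eq hκ₁ hκ₂ hι₂ hB (hUW.mono fun ζ ⟨_, _, h, _⟩ => h) (hV f) hf
  · exact hι₂.nonneg_of_apply_eq hκ₂ hκ₁ hι₁ hB' (hUW.mono fun ζ ⟨_, _, _, h⟩ => h) (hV' g) hg
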